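/- Let $M\ge 1$, $\mu_1,\dots,\mu_M>0$, $\beta>0$, and let $\mathbf A=(\alpha_{i,j})\in\mathbb R^{M\times M}$ with $\alpha_{i,j}\ge 0$. For a realization $\{(u_k,t_k)\}$ of events (node $u_k\in[M]$, distinct times $t_k>0$, finitely many in every bounded window) and $T>0$, let $$\ell_T(\mathbf A)=\sum_{t_k<T}\log\Big(\mu_{u_k}+\sum_{t_i<t_k}\alpha_{u_i,u_k}e^{-\beta(t_k-t_i)}\Big)-\sum_{m=1}^M\mu_mT+\frac1\beta\sum_{m=1}^M\sum_{t_k<T}\alpha_{u_k,m}\big[e^{-\beta(T-t_k)}-1\big]$$ be the log-likelihood of the multivariate Hawkes process with exponential kernel, let $\mathcal C(i,t)=\{k: t_k<t,\ u_k=i\}$, and let $S_T^{(p,q)}(\mathbf A)=\partial\ell_T(\mathbf A)/\partial\alpha_{p,q}$. Then for all $p,q\in[M]$ this derivative exists and $$S_T^{(p,q)}(\mathbf A)=\sum_{k\in\mathcal C(q,T)}\frac{\sum_{i\in\mathcal C(p,t_k)}e^{-\beta(t_k-t_i)}}{\mu_q+\sum_{t_i<t_k}\alpha_{u_i,q}e^{-\beta(t_k-t_i)}}+\frac1\beta\sum_{k\in\mathcal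 C(p,T)}\big[e^{-\beta(T-t_k)}-1\big].$$ Let now the events be generated by a multivariate Hawkes process started at time $0$ with an empty past, that is, let the counting process $N_m$ of the events at node $m$ have, for every $m$, with respect to the history $\mathcal H_t=\sigma(N_i(s): i\in[M],\,s\le t)$, the conditional intensity $\lambda_m(t)=\mu_m+\sum_{t_i<t}\alpha_{u_i,m}e^{-\beta(t-t_i)}$, in the sense that $N_m(t)-\int_0^t\lambda_m(s)\,ds$ is an $(\mathcal H_t)$-martingale. If $\mathbf A=\mathbf 0$ (so that $N_1,\dots,N_M$ are independent Poisson processes with rates $\mu_1,\dots,\mu_M$), then every $S_T^{(p,q)}(\mathbf 0)$ is square integrable, and as $T\to\infty$ $$\operatorname{Var}\big[T^{-1/2}S_T^{(q,q)}(\mathbf 0)\big]\to\frac1{2\beta}+\frac{\mu_q}{\beta^2}\quad\text{for all }q,$$ $$\operatorname{Var}\big[T^{-1/2}S_T^{(p,q)}(\mathbf 0)\big]\to\frac{\mu_p}{\mu_q}\Big(\frac1{2\beta}+\frac{\mu_p}{\beta^2}\Big)\quad\text{for } p\ne q,$$ $$\operatorname{Cov}\big[T^{-1/2}S_T^{(p,q)}(\mathbf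 0),\,T^{-1/2}S_T^{(p',q)}(\mathbf 0)\big]\to\frac{\mu_p\mu_{p'}}{\mu_q\beta^2}\quad\text{for } p\ne p',$$ and all the remaining limits vanish: $\operatorname{Cov}\big[T^{-1/2}S_T^{(p,q)}(\mathbf 0),\,T^{-1/2}S_T^{(p',q')}(\mathbf 0)\big]\to 0$ whenever $q\ne q'$. -/

import Mathlib

open MeasureTheory ProbabilityTheory Filter
open scoped Topology NNReal

noncomputable section

namespace Hawkes

/-- A realization of a marked point process on the nodes `Fin M`: a set of events `(t, u)`
(`t` the time, `u` the node of the event), with positive times, finitely many events in every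
bounded time window, and no two events at the same time. -/
structure Realization (M : ℕ) where
  events : Set (ℝ × Fin M)
  time_pos : ∀ e ∈ events, 0 < e.1
  finite_upTo : ∀ t : ℝ, {e ∈ events | e.1 ≤ t}.Finite
  simple : Set.InjOn Prod.fst events

namespace Realization

variable {M : ℕ}

theorem finite_lt (x : Realization M) (t : ℝ) : {e ∈ x.events | e.1 < t}.Finite :=
  (x.finite_upTo t).subset fun _ he => ⟨he.1, he.2.le⟩

/-- The events strictly before time `t`. -/
def before (x : Realization M) (t : ℝ) : Finset (ℝ × Fin M) :=
  (x.finite_lt t).toFinset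

/-- `𝒞(i, t)`: the events at node `i` strictly before time `t`. -/
def nodeBefore (x : Realization M) (i : Fin M) (t : ℝ) : Finset (ℝ × Fin M) :=
  (x.before t).filter fun e => e.2 = i

/-- `N_m(t)`: the number of events at node `m` up to and including time `t`. -/
def count (x : Realization M) (m : Fin M) (t : ℝ) : ℕ :=
  {e ∈ x.events | e.1 ≤ t ∧ e.2 = m}.ncard

/-- The intensity `λ_m(t) = μ_m + ∑_{t_i < t} α_{u_i, m} e^{-β (t - t_i)}` of node `m` at time `t`,
for base intensities `μ`, influence matrix `A = (α_{i,j})` and decay rate `β`. -/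
def intensity (x : Realization M) (μ : Fin M → ℝ) (β : ℝ) (A : Matrix (Fin M) (Fin M) ℝ)
    (m : Fin M) (t : ℝ) : ℝ :=
  μ m + ∑ e ∈ x.before t, A e.2 m * Real.exp (-β * (t - e.1))

/-- The log-likelihood `ℓ_T(A)` of the events before time `T`. -/
def logLikelihood (x : Realization M) (μ : Fin M → ℝ) (β T : ℝ)
    (A : Matrix (Fin M) (Fin M) ℝ) : ℝ :=
  (∑ k ∈ x.before T,
      Real.log (μ k.2 + ∑ i ∈ x.before k.1, A i.2 k.2 * Real.exp (-β * (k.1 - i.1))))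
    - ∑ m, μ m * T
    + (1 / β) * ∑ m, ∑ k ∈ x.before T, A k.2 m * (Real.exp (-β * (T - k.1)) - 1)

/-- The score `S_T^{(p,q)}(A) = ∂ℓ_T(A) / ∂α_{p,q}`: the derivative of the log-likelihood at `A`
in the direction of the `(p, q)`-th coordinate. -/
def score (x : Realization M) (μ : Fin M → ℝ) (β T : ℝ) (p q : Fin M)
    (A : Matrix (Fin M) (Fin M) ℝ) : ℝ :=
  lineDeriv ℝ (x.logLikelihood μ β T) A (Matrix.single p q 1)

end Realization

variable {M : ℕ} {Ω : Type*} [MeasurableSpace Ω]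

/-- The vector of counting processes `(N_m(t))_m`. -/
def counts (N : Ω → Realization M) (t : ℝ≥0) (ω : Ω) : Fin M → ℝ :=
  fun m => ((N ω).count m t : ℝ)

/-- `N` is a multivariate Hawkes process with exponential kernel `α_{i,j} e^{-β t}`, started at
time `0` with an empty past: its counting processes are random variables, and for every node
`m` the conditional intensity of `N_m` with respect to the history `ℋ_t = σ(N_i(s) : i, s ≤ t)` is
`λ_m(t) = μ_m + ∑_i ∫_0^t α_{i,m} e^{-β (t - s)} N_i(ds)`, in the sense that
`N_m(t) - ∫_0^t λ_m(s) ds` is a martingale with respect to the history. -/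
structure IsHawkes (P : Measure Ω) (N : Ω → Realization M) (μ : Fin M → ℝ) (β : ℝ)
    (A : Matrix (Fin M) (Fin M) ℝ) : Prop where
  stronglyMeasurable_counts : ∀ t, StronglyMeasurable (counts N t)
  martingale : ∀ m, Martingale
    (fun (t : ℝ≥0) ω => counts N t ω m - ∫ s in (0 : ℝ)..t, (N ω).intensity μ β A m s)
    (Filtration.natural (counts N) stronglyMeasurable_counts) P

/-- The normalized score `T^{-1/2} S_T^{(p,q)}(A)`, as a random variable. -/
def normalizedScore (N : Ω → Realization M) (μ : Fin M → ℝ) (β T : ℝ) (p q : Fin M)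
    (A : Matrix (Fin M) (Fin M) ℝ) (ω : Ω) : ℝ :=
  T ^ (-(1 / 2) : ℝ) * (N ω).score μ β T p q A

end Hawkes

end

/-!
At `A = 0` differentiating the log-likelihood gives
`S_T^{(p,q)} = μ_q⁻¹ ∫_0^T R_p (dN_q - μ_q ds)`, where `R_p(t) = ∑_{s < t} e^{-β (t - s)}` runs over
the events `s` at node `p`: the second sum in the score is `∫_0^T R_p ds`. The scores are therefore
stochastic integrals with respect to the martingales `N_q(t) - μ_q t`, and the Itô isometry gives
`Cov[S_T^{(p,q)}, S_T^{(p',q')}] = δ_{q q'} μ_q⁻¹ ∫_0^T 𝔼[R_p R_p'] ds`. Since `R_p(t)` is, up to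
its mean, itself the stochastic integral of the kernel, a second application of the isometry shows
that `𝔼[R_p R_p']` converges to `δ_{p p'} μ_p / (2β) + μ_p μ_p' / β²`, and so do its averages over
`[0, T]`.

The isometry is proved by approximation with sums over equidistant grids. These are dominated by
powers of the counts, whose moments are finite for the following reason. For the increments `Δ` of
a process of rate `r`, the bound `2^(2Δ - Δ²) ≤ 1 + Δ` gives `𝔼[2^(∑ (2Δ - Δ²))] ≤ e^(r T)`. The
events at a node are never simultaneous, so `∑ (2Δ - Δ²)` tends to `N(T)` as the grid is refined,
and hence `𝔼[2^N(T)] ≤ e^(r T)` by Fatou's lemma.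
-/

noncomputable section

namespace Hawkes

namespace Realization

variable {M : ℕ} (x : Realization M)

/-! ### The score of a realization -/

section Score

variable {μ : Fin M → ℝ} (hμ : ∀ m, 0 < μ m) (β T : ℝ) {A : Matrix (Fin M) (Fin M) ℝ}
  (hA : ∀ i j, 0 ≤ A i j)

include hμ hA in
theorem intensity_pos (m : Fin M) (t : ℝ) : 0 < x.intensity μ β A m t :=
  add_pos_of_pos_of_nonneg (hμ m) (Finset.sum_nonneg fun _ _ =>
    mul_nonneg (hA _ _) (Real.exp_pos _).le)

theorem hasDerivAt_add_smul_apply (A E : Matrix (Fin M) (Fin M) ℝ) (i j : Fin M) :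
    HasDerivAt (fun t : ℝ => (A + t • E) i j) (E i j) 0 := by
  simpa using ((hasDerivAt_id (0 : ℝ)).mul_const (E i j)).const_add (A i j)

include hμ hA in
theorem hasLineDerivAt_log_intensity (E : Matrix (Fin M) (Fin M) ℝ) (m : Fin M) (t : ℝ) :
    HasLineDerivAt ℝ (fun A => Real.log (x.intensity μ β A m t))
      ((∑ i ∈ x.before t, E i.2 m * Real.exp (-β * (t - i.1))) / x.intensity μ β A m t) A E := by
  have h := (HasDerivAt.fun_sum (u := x.before t) fun i _ =>
    (hasDerivAt_add_smul_apply A E i.2 m).mul_const (Real.exp (-β * (t - i.1)))).const_add (μ m)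
  simpa [HasLineDerivAt, intensity] using h.log (by
    simpa [intensity] using (x.intensity_pos hμ β hA m t).ne')

theorem sum_before_ite (m : Fin M) (t : ℝ) (f : ℝ × Fin M → ℝ) :
    ∑ e ∈ x.before t, (if e.2 = m then f e else 0) = ∑ e ∈ x.nodeBefore m t, f e :=
  (Finset.sum_filter _ _).symm

include hμ hA in
theorem hasLineDerivAt_logLikelihood (p q : Fin M) :
    HasLineDerivAt ℝ (x.logLikelihood μ β T)
      ((∑ k ∈ x.nodeBefore q T,
          (∑ i ∈ x.nodeBefore p k.1, Real.exp (-β * (k.1 - i.1))) /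
            (μ q + ∑ i ∈ x.before k.1, A i.2 q * Real.exp (-β * (k.1 - i.1))))
        + (1 / β) * ∑ k ∈ x.nodeBefore p T, (Real.exp (-β * (T - k.1)) - 1))
      A (Matrix.single p q 1) := by
  have hlog := HasDerivAt.fun_sum (u := x.before T) fun k _ =>
    x.hasLineDerivAt_log_intensity hμ β hA (Matrix.single p q 1) k.2 k.1
  have hcomp := (HasDerivAt.fun_sum (u := Finset.univ) fun m _ =>
    HasDerivAt.fun_sum (u := x.before T) fun k _ =>
      (hasDerivAt_add_smul_apply A (Matrix.single p q 1) k.2 m).mul_const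
        (Real.exp (-β * (T - k.1)) - 1)).const_mul (1 / β)
  have hsingle : ∀ i j : Fin M, (Matrix.single p q 1 : Matrix (Fin M) (Fin M) ℝ) i j =
      if j = q then (if i = p then 1 else 0) else 0 := fun i j => by
    simp only [Matrix.single_apply, ← ite_and, and_comm, eq_comm]
  refine HasDerivAt.congr_deriv ((hlog.sub_const (∑ m, μ m * T)).add hcomp) ?_
  rw [← sum_before_ite, ← sum_before_ite, Finset.sum_comm]
  congr 1
  · refine Finset.sum_congr rfl fun k _ => ?_
    split_ifs with hk
    · simp only [hsingle, hk, if_true, ite_mul, one_mul, zero_mul, sum_before_ite, intensity]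
    · simp only [hsingle, hk, if_false, zero_mul, Finset.sum_const_zero, zero_div]
  · congr 1
    refine Finset.sum_congr rfl fun k _ => ?_
    simp only [hsingle, ite_mul, one_mul, zero_mul, Finset.sum_ite_eq', Finset.mem_univ, if_true]

/-- `R_m(t)`: the sum of the kernel `e^{-β (t - s)}` over the events at node `m` at times `s`
strictly before `t`. -/
def excitation (m : Fin M) (t : ℝ) : ℝ := ∑ e ∈ x.nodeBefore m t, Real.exp (-β * (t - e.1))

include hμ in
theorem score_zero (p q : Fin M) :
    x.score μ β T p q 0 =
      (∑ k ∈ x.nodeBefore q T, x.excitation β p k.1) / μ q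
        - ∑ k ∈ x.nodeBefore p T, (1 - Real.exp (-β * (T - k.1))) / β := by
  rw [score, (x.hasLineDerivAt_logLikelihood hμ β T (A := 0) (fun _ _ => le_rfl) p q).lineDeriv]
  simp only [Matrix.zero_apply, zero_mul, Finset.sum_const_zero, add_zero, Finset.sum_div,
    sub_eq_add_neg, Finset.mul_sum, ← Finset.sum_neg_distrib, excitation]
  congr 1
  exact Finset.sum_congr rfl fun k _ => by ring

end Score

/-! ### The counting measures of a realization -/

/-- The times of the events at node `m`. -/
def nodeTimes (m : Fin M) : Set ℝ := {t | (t, m) ∈ x.events}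

/-- The counting measure of the times of the events at node `m`, which has distribution function
`N_m`. -/
def nodeMeasure (m : Fin M) : Measure ℝ := Measure.count.restrict (x.nodeTimes m)

variable {x} {m : Fin M} {s t : ℝ}

theorem mem_nodeBefore {e : ℝ × Fin M} :
    e ∈ x.nodeBefore m t ↔ (e ∈ x.events ∧ e.1 < t) ∧ e.2 = m := by
  rw [nodeBefore, before, Finset.mem_filter, Set.Finite.mem_toFinset, Set.mem_ofPred_eq]

variable (x m)

theorem finite_Iic_inter_nodeTimes (t : ℝ) : (Set.Iic t ∩ x.nodeTimes m).Finite :=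
  ((x.finite_upTo t).image Prod.fst).subset fun s hs => ⟨(s, m), ⟨hs.2, hs.1⟩, rfl⟩

theorem measurableSet_nodeTimes : MeasurableSet (x.nodeTimes m) := by
  have h : x.nodeTimes m = ⋃ n : ℕ, Set.Iic (n : ℝ) ∩ x.nodeTimes m := by
    rw [← Set.iUnion_inter, eq_comm, Set.inter_eq_right]
    exact fun t _ => Set.mem_iUnion.2 (exists_nat_ge t)
  rw [h]
  exact MeasurableSet.iUnion fun n => (x.finite_Iic_inter_nodeTimes m n).measurableSet

theorem nodeMeasure_Iic (t : ℝ) : x.nodeMeasure m (Set.Iic t) = x.count m t := by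
  have himage : {e ∈ x.events | e.1 ≤ t ∧ e.2 = m} =
      (fun s => (s, m)) '' (Set.Iic t ∩ x.nodeTimes m) := by
    ext ⟨s, m'⟩
    constructor
    · rintro ⟨he, hst, rfl⟩
      exact ⟨s, ⟨hst, he⟩, rfl⟩
    · rintro ⟨s, ⟨hst, he⟩, ⟨⟩⟩
      exact ⟨he, hst, rfl⟩
  rw [nodeMeasure, Measure.restrict_apply measurableSet_Iic, count, himage,
    Set.ncard_image_of_injective _ fun _ _ h => congrArg Prod.fst h]
  rw [Set.ncard_eq_toFinset_card _ (x.finite_Iic_inter_nodeTimes m t)]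
  exact Measure.count_apply_finite _ (x.finite_Iic_inter_nodeTimes m t)

instance : IsLocallyFiniteMeasure (x.nodeMeasure m) :=
  ⟨fun t => ⟨Set.Iic (t + 1), Iic_mem_nhds (lt_add_one t), by
    rw [nodeMeasure_Iic]
    exact ENNReal.natCast_lt_top _⟩⟩

theorem nodeMeasure_real_Ioc (hst : s ≤ t) :
    (x.nodeMeasure m).real (Set.Ioc s t) = x.count m t - x.count m s := by
  have hreal : ∀ t, (x.nodeMeasure m).real (Set.Iic t) = x.count m t := fun t => by
    rw [measureReal_def, nodeMeasure_Iic, ENNReal.toReal_natCast]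
  rw [← Set.Iic_sdiff_Iic, measureReal_sdiff (Set.Iic_subset_Iic.2 hst) measurableSet_Iic
    (by rw [nodeMeasure_Iic]; exact ENNReal.natCast_ne_top _), hreal, hreal]

theorem count_mono : Monotone (x.count m) := fun s t hst => by
  have h := measure_mono (μ := x.nodeMeasure m) (Set.Iic_subset_Iic.2 hst)
  rw [nodeMeasure_Iic, nodeMeasure_Iic] at h
  exact_mod_cast h

theorem count_zero : x.count m 0 = 0 := by
  rw [count, Set.ncard_eq_zero ((x.finite_upTo 0).subset fun e he => ⟨he.1, he.2.1⟩),
    Set.eq_empty_iff_forall_notMem]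
  exact fun e he => (x.time_pos e he.1).not_ge he.2.1

theorem nodeMeasure_real_Ioc_zero (ht : 0 ≤ t) :
    (x.nodeMeasure m).real (Set.Ioc 0 t) = x.count m t := by
  rw [nodeMeasure_real_Ioc x m ht, count_zero, Nat.cast_zero, sub_zero]

theorem ae_mem_nodeTimes : ∀ᵐ s ∂x.nodeMeasure m, s ∈ x.nodeTimes m :=
  ae_restrict_mem (x.measurableSet_nodeTimes m)

theorem nodeMeasure_real_singleton (t : ℝ) :
    (x.nodeMeasure m).real {t} = (x.nodeTimes m).indicator 1 t := by
  rw [nodeMeasure, measureReal_def, Measure.restrict_apply (measurableSet_singleton t)]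
  by_cases h : t ∈ x.nodeTimes m
  · rw [Set.inter_eq_left.2 (Set.singleton_subset_iff.2 h), Measure.count_singleton,
      ENNReal.toReal_one, Set.indicator_of_mem h, Pi.one_apply]
  · rw [Set.singleton_inter_eq_empty.2 h, measure_empty, ENNReal.toReal_zero,
      Set.indicator_of_notMem h]

theorem nodeMeasure_real_singleton_ae_eq (m' : Fin M) :
    ∀ᵐ s ∂x.nodeMeasure m, (x.nodeMeasure m').real {s} = if m = m' then 1 else 0 := by
  filter_upwards [x.ae_mem_nodeTimes m] with s hs
  rw [nodeMeasure_real_singleton]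
  split_ifs with h
  · exact Set.indicator_of_mem (h ▸ hs) 1
  · exact Set.indicator_of_notMem (fun hs' =>
      h (Prod.mk.inj (x.simple (x₁ := (s, m)) (x₂ := (s, m')) hs hs' rfl)).2) 1

theorem intervalIntegral_mul_nodeMeasure_real_singleton (m' : Fin M) (f : ℝ → ℝ) (a b : ℝ) :
    ∫ s in a..b, f s * (x.nodeMeasure m').real {s} ∂x.nodeMeasure m =
      if m = m' then ∫ s in a..b, f s ∂x.nodeMeasure m else 0 := by
  rw [intervalIntegral.integral_congr_ae ((x.nodeMeasure_real_singleton_ae_eq m m').mono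
    fun s hs _ => congrArg (f s * ·) hs)]
  split_ifs
  · simp only [mul_one]
  · simp only [mul_zero, intervalIntegral.integral_zero]

theorem setIntegral_Iio_nodeMeasure (f : ℝ → ℝ) (t : ℝ) :
    ∫ s in Set.Iio t, f s ∂x.nodeMeasure m = ∑ e ∈ x.nodeBefore m t, f e.1 := by
  have himage : Set.Iio t ∩ x.nodeTimes m = ((x.nodeBefore m t).image Prod.fst : Finset ℝ) := by
    ext s
    simp only [Finset.coe_image, Set.mem_image, Finset.mem_coe, mem_nodeBefore]
    constructor
    · rintro ⟨hst, he⟩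
      exact ⟨(s, m), ⟨⟨he, hst⟩, rfl⟩, rfl⟩
    · rintro ⟨e, ⟨⟨he, hst⟩, rfl⟩, rfl⟩
      exact ⟨hst, he⟩
  rw [nodeMeasure, Measure.restrict_restrict measurableSet_Iio, himage, setIntegral_finset,
    Finset.sum_image fun e he e' he' h =>
      x.simple (mem_nodeBefore.1 he).1.1 (mem_nodeBefore.1 he').1.1 h]
  · simp only [measureReal_def, Measure.count_singleton, ENNReal.toReal_one, one_smul]
  · exact (integrableOn_finset_iUnion.2 fun s _ => integrableOn_singleton
      (hx := by simp)).mono_set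
      fun s hs => Set.mem_iUnion₂.2 ⟨s, hs, rfl⟩

end Realization

/-! ### Riemann sums on equidistant grids -/

/-- The `j`-th point of the grid that divides `[0, T]` into `n + 1` cells of equal length. -/
def gridPoint (T : ℝ≥0) (n j : ℕ) : ℝ≥0 := j * (T / (n + 1))

/-- The `j`-th cell of the grid. It contains its right endpoint only, so that the left endpoint of
the cell around `s` is strictly before `s`. -/
def gridCell (T : ℝ≥0) (n j : ℕ) : Set ℝ := Set.Ioc (gridPoint T n j) (gridPoint T n (j + 1))

/-- The index of the grid cell that contains `s`. -/
def gridIndex (T : ℝ≥0) (n : ℕ) (s : ℝ) : ℕ := ⌈s / (T / (n + 1))⌉₊ - 1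

section Grid

variable {T : ℝ≥0} {n j : ℕ} {s : ℝ}

theorem gridPoint_mono (T : ℝ≥0) (n : ℕ) : Monotone (gridPoint T n) := fun i j hij => by
  unfold gridPoint
  gcongr

theorem gridPoint_zero (T : ℝ≥0) (n : ℕ) : gridPoint T n 0 = 0 := by
  rw [gridPoint, Nat.cast_zero, zero_mul]

theorem gridPoint_last (T : ℝ≥0) (n : ℕ) : gridPoint T n (n + 1) = T := by
  rw [gridPoint, Nat.cast_succ, mul_div_cancel₀ _ (by positivity)]

theorem gridPoint_le (hj : j ≤ n + 1) : gridPoint T n j ≤ T :=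
  (gridPoint_mono T n hj).trans_eq (gridPoint_last T n)

theorem gridPoint_mem_Icc (hj : j ≤ n + 1) : (gridPoint T n j : ℝ) ∈ Set.Icc 0 (T : ℝ) :=
  ⟨NNReal.coe_nonneg _, gridPoint_le hj⟩

theorem gridPoint_succ (T : ℝ≥0) (n j : ℕ) :
    (gridPoint T n (j + 1) : ℝ) = gridPoint T n j + T / (n + 1) := by
  simp only [gridPoint]
  push_cast
  ring

theorem mem_gridCell_gridIndex (hs : s ∈ Set.Ioc 0 (T : ℝ)) :
    s ∈ gridCell T n (gridIndex T n s) := by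
  have hT : 0 < (T : ℝ) := hs.1.trans_le hs.2
  have hh : 0 < (T : ℝ) / (n + 1) := by positivity
  have hpos : 0 < s / (T / (n + 1)) := div_pos hs.1 hh
  have h := (Nat.ceil_eq_iff (Nat.ceil_pos.2 hpos).ne').1 rfl
  rw [lt_div_iff₀ hh, div_le_iff₀ hh] at h
  rw [gridCell, gridPoint, gridPoint, gridIndex, Nat.sub_add_cancel (Nat.ceil_pos.2 hpos)]
  exact_mod_cast h

theorem gridIndex_lt (hs : s ∈ Set.Ioc 0 (T : ℝ)) : gridIndex T n s < n + 1 := by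
  by_contra! h
  have := (mem_gridCell_gridIndex (n := n) hs).1.trans_le hs.2
  rw [NNReal.coe_lt_coe, ← not_le] at this
  exact this ((gridPoint_last T n).ge.trans (gridPoint_mono T n h))

theorem gridIndex_eq (hs : s ∈ gridCell T n j) : gridIndex T n s = j := by
  have hh : 0 < (T : ℝ) / (n + 1) := by
    have h := hs.1.trans_le hs.2
    rwa [gridPoint_succ, lt_add_iff_pos_right] at h
  have h : s / (T / (n + 1)) ∈ Set.Ioc (j : ℝ) (j + 1 : ℕ) := by
    simp only [gridCell, gridPoint, Set.mem_Ioc] at hs ⊢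
    rw [lt_div_iff₀ hh, div_le_iff₀ hh]
    exact_mod_cast hs
  rw [gridIndex, (Nat.ceil_eq_iff j.succ_ne_zero).2 h, Nat.succ_sub_one]

theorem gridCell_subset (hj : j < n + 1) : gridCell T n j ⊆ Set.Ioc 0 (T : ℝ) :=
  Set.Ioc_subset_Ioc (NNReal.coe_nonneg _) (NNReal.coe_le_coe.2 (gridPoint_le hj))

theorem gridCell_subset_closedBall (hs : s ∈ gridCell T n j) :
    gridCell T n j ⊆ Metric.closedBall s (T / (n + 1)) := fun u hu => by
  rw [gridCell, gridPoint_succ] at hs hu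
  rw [Metric.mem_closedBall, Real.dist_eq, abs_le]
  constructor <;> linarith [hs.1, hs.2, hu.1, hu.2]

theorem tendsto_gridMesh (T : ℝ≥0) : Tendsto (fun n : ℕ => (T : ℝ) / (n + 1)) atTop (𝓝 0) :=
  tendsto_const_nhds.div_atTop (tendsto_natCast_atTop_atTop.atTop_add tendsto_const_nhds)

theorem tendsto_gridPoint_gridIndex (hs : s ∈ Set.Ioc 0 (T : ℝ)) :
    Tendsto (fun n => (gridPoint T n (gridIndex T n s) : ℝ)) atTop (𝓝[≤] s) := by
  refine tendsto_nhdsWithin_iff.2 ⟨?_, Eventually.of_forall fun n =>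
    (mem_gridCell_gridIndex hs).1.le⟩
  refine tendsto_of_tendsto_of_tendsto_of_le_of_le (g := fun n : ℕ => s - (T : ℝ) / (n + 1))
    (by simpa using (tendsto_gridMesh T).const_sub s) tendsto_const_nhds (fun n => ?_)
    fun n => (mem_gridCell_gridIndex hs).1.le
  rw [sub_le_iff_le_add, ← gridPoint_succ]
  exact (mem_gridCell_gridIndex hs).2

end Grid

section RiemannSums

variable {T : ℝ≥0} {ν ν' : Measure ℝ} [IsLocallyFiniteMeasure ν] [IsLocallyFiniteMeasure ν']

theorem measurable_gridIndex (T : ℝ≥0) (n : ℕ) : Measurable (gridIndex T n) :=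
  (measurable_of_countable (· - 1)).comp (Nat.measurable_ceil.comp (measurable_id.div_const _))

theorem intervalIntegrable_comp_gridIndex (n : ℕ) (g : ℕ → ℝ) {a b : ℝ}
    (hab : Set.uIoc a b ⊆ Set.Ioc 0 (T : ℝ)) :
    IntervalIntegrable (fun s => g (gridIndex T n s)) ν a b := by
  obtain ⟨C, hC⟩ := ((Set.finite_Iio (n + 1)).image fun j => ‖g j‖).bddAbove
  refine (intervalIntegrable_const (c := C)).mono_fun
    ((measurable_of_countable g).comp (measurable_gridIndex T n)).aestronglyMeasurable ?_
  refine (ae_restrict_iff' measurableSet_uIoc).2 (Eventually.of_forall fun s hs => ?_)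
  exact (hC ⟨_, gridIndex_lt (hab hs), rfl⟩).trans (le_abs_self C)

theorem integral_comp_gridIndex (n : ℕ) (g : ℕ → ℝ) :
    ∫ s in (0 : ℝ)..T, g (gridIndex T n s) ∂ν =
      ∑ j ∈ Finset.range (n + 1), g j * ν.real (gridCell T n j) := by
  have hcell : ∀ j, (gridPoint T n j : ℝ) ≤ gridPoint T n (j + 1) := fun j =>
    gridPoint_mono T n j.le_succ
  have h := intervalIntegral.sum_integral_adjacent_intervals (n := n + 1) (μ := ν)
    (f := fun s => g (gridIndex T n s)) (a := fun j => gridPoint T n j) fun j hj =>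
      intervalIntegrable_comp_gridIndex n g (by
        rw [Set.uIoc_of_le (hcell j)]
        exact gridCell_subset hj)
  rw [gridPoint_zero, gridPoint_last, NNReal.coe_zero] at h
  rw [← h]
  refine Finset.sum_congr rfl fun j _ => ?_
  rw [intervalIntegral.integral_of_le (hcell j), setIntegral_congr_fun measurableSet_Ioc
    fun s hs => congrArg g (gridIndex_eq hs), setIntegral_const, smul_eq_mul, mul_comm, gridCell]

theorem tendsto_sum_mul_measureReal_gridCell {g : ℕ → ℕ → ℝ} {C : ℝ}
    (hg : ∀ n, ∀ j < n + 1, |g n j| ≤ C) {F : ℝ → ℝ}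
    (hF : ∀ s ∈ Set.Ioc 0 (T : ℝ), Tendsto (fun n => g n (gridIndex T n s)) atTop (𝓝 (F s))) :
    Tendsto (fun n => ∑ j ∈ Finset.range (n + 1), g n j * ν.real (gridCell T n j)) atTop
      (𝓝 (∫ s in (0 : ℝ)..T, F s ∂ν)) := by
  have hT : Set.uIoc 0 (T : ℝ) = Set.Ioc 0 (T : ℝ) := Set.uIoc_of_le T.2
  simp_rw [← integral_comp_gridIndex]
  refine intervalIntegral.tendsto_integral_filter_of_dominated_convergence (fun _ => C)
    (Eventually.of_forall fun n => ?_)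
    (Eventually.of_forall fun n => Eventually.of_forall fun s hs => ?_)
    intervalIntegrable_const (Eventually.of_forall fun s hs => hF s (hT ▸ hs))
  · exact ((measurable_of_countable _).comp (measurable_gridIndex T n)).aestronglyMeasurable
  · exact hg n _ (gridIndex_lt (hT ▸ hs))

theorem tendsto_measureReal_gridCell {s : ℝ} (hs : s ∈ Set.Ioc 0 (T : ℝ)) :
    Tendsto (fun n => ν.real (gridCell T n (gridIndex T n s))) atTop (𝓝 (ν.real {s})) := by
  have hball : Tendsto (fun n : ℕ => ν.real (Metric.closedBall s (T / (n + 1)))) atTop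
      (𝓝 (ν.real {s})) := by
    have h := (tendsto_measure_cthickening_of_isClosed (μ := ν) ⟨1, one_pos, by
      simpa [Metric.cthickening_singleton s zero_le_one] using
        (measure_closedBall_lt_top (x := s) (r := 1)).ne⟩ (isClosed_singleton (x := s))).comp
      (tendsto_gridMesh T)
    refine ((ENNReal.tendsto_toReal isCompact_singleton.measure_lt_top.ne).comp h).congr fun n => ?_
    rw [Function.comp_apply, Function.comp_apply, Metric.cthickening_singleton s (by positivity)]
    rfl
  refine tendsto_of_tendsto_of_tendsto_of_le_of_le tendsto_const_nhds hball (fun n => ?_)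
    fun n => ?_
  · exact measureReal_mono (Set.singleton_subset_iff.2 (mem_gridCell_gridIndex hs))
      measure_Ioc_lt_top.ne
  · exact measureReal_mono (gridCell_subset_closedBall (mem_gridCell_gridIndex hs))
      measure_closedBall_lt_top.ne

theorem sum_measureReal_gridCell (ν : Measure ℝ) [IsLocallyFiniteMeasure ν] (T : ℝ≥0) (n : ℕ) :
    ∑ j ∈ Finset.range (n + 1), ν.real (gridCell T n j) = ν.real (Set.Ioc 0 (T : ℝ)) := by
  have h := integral_comp_gridIndex (T := T) (ν := ν) n fun _ => 1
  rw [intervalIntegral.integral_of_le T.coe_nonneg, setIntegral_const, smul_eq_mul, mul_one] at h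
  simpa only [one_mul] using h.symm

theorem abs_sum_mul_measureReal_gridCell_le {g : ℕ → ℝ} {C : ℝ} {n : ℕ}
    (hg : ∀ j < n + 1, |g j| ≤ C) :
    |∑ j ∈ Finset.range (n + 1), g j * ν.real (gridCell T n j)| ≤
      C * ν.real (Set.Ioc 0 (T : ℝ)) := by
  rw [← sum_measureReal_gridCell ν T n, Finset.mul_sum]
  refine (Finset.abs_sum_le_sum_abs _ _).trans (Finset.sum_le_sum fun j hj => ?_)
  rw [abs_mul, abs_of_nonneg (measureReal_nonneg (μ := ν))]
  exact mul_le_mul_of_nonneg_right (hg j (Finset.mem_range.1 hj)) measureReal_nonneg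

variable {f : ℝ → ℝ} {C : ℝ}

theorem abs_mul_measureReal_gridCell_le (hC : ∀ s ∈ Set.Icc 0 (T : ℝ), |f s| ≤ C) {n j : ℕ}
    (hj : j < n + 1) :
    |f (gridPoint T n j) * ν.real (gridCell T n j)| ≤ C * ν.real (Set.Ioc 0 (T : ℝ)) := by
  rw [abs_mul, abs_of_nonneg (measureReal_nonneg (μ := ν))]
  exact mul_le_mul (hC _ (gridPoint_mem_Icc hj.le))
    (measureReal_mono (gridCell_subset hj) measure_Ioc_lt_top.ne) measureReal_nonneg
    ((abs_nonneg _).trans (hC 0 ⟨le_rfl, T.2⟩))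

theorem abs_leftRiemannSum_le (hC : ∀ s ∈ Set.Icc 0 (T : ℝ), |f s| ≤ C) (n : ℕ) :
    |∑ j ∈ Finset.range (n + 1), f (gridPoint T n j) * ν.real (gridCell T n j)| ≤
      C * ν.real (Set.Ioc 0 (T : ℝ)) :=
  abs_sum_mul_measureReal_gridCell_le fun _ hj => hC _ (gridPoint_mem_Icc hj.le)

theorem abs_leftRiemannSum_mul_le (hC : ∀ s ∈ Set.Icc 0 (T : ℝ), |f s| ≤ C) (n : ℕ) :
    |∑ j ∈ Finset.range (n + 1),
        f (gridPoint T n j) * ν'.real (gridCell T n j) * ν.real (gridCell T n j)| ≤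
      C * ν'.real (Set.Ioc 0 (T : ℝ)) * ν.real (Set.Ioc 0 (T : ℝ)) :=
  abs_sum_mul_measureReal_gridCell_le fun _ hj => abs_mul_measureReal_gridCell_le hC hj

theorem tendsto_leftRiemannSum (hf : ∀ s ∈ Set.Ioc 0 (T : ℝ), ContinuousWithinAt f (Set.Iic s) s)
    (hC : ∀ s ∈ Set.Icc 0 (T : ℝ), |f s| ≤ C) :
    Tendsto (fun n => ∑ j ∈ Finset.range (n + 1), f (gridPoint T n j) * ν.real (gridCell T n j))
      atTop (𝓝 (∫ s in (0 : ℝ)..T, f s ∂ν)) :=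
  tendsto_sum_mul_measureReal_gridCell (fun _ _ hj => hC _ (gridPoint_mem_Icc hj.le))
    fun s hs => (hf s hs).tendsto.comp (tendsto_gridPoint_gridIndex hs)

theorem tendsto_leftRiemannSum_mul
    (hf : ∀ s ∈ Set.Ioc 0 (T : ℝ), ContinuousWithinAt f (Set.Iic s) s)
    (hC : ∀ s ∈ Set.Icc 0 (T : ℝ), |f s| ≤ C) :
    Tendsto (fun n => ∑ j ∈ Finset.range (n + 1),
        f (gridPoint T n j) * ν'.real (gridCell T n j) * ν.real (gridCell T n j))
      atTop (𝓝 (∫ s in (0 : ℝ)..T, f s * ν'.real {s} ∂ν)) :=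
  tendsto_sum_mul_measureReal_gridCell (fun _ _ => abs_mul_measureReal_gridCell_le hC)
    fun s hs => ((hf s hs).tendsto.comp (tendsto_gridPoint_gridIndex hs)).mul
      (tendsto_measureReal_gridCell hs)

end RiemannSums

/-! ### Elementary stochastic integrals -/

section Elementary

variable {Ω : Type*}

/-- The elementary stochastic integral `∑_{j < n} Y_j (X_{τ (j + 1)} - X_{τ j})` of the sequence
`Y` with respect to the process `X` along the times `τ`. -/
def elementaryIntegral {ι : Type*} (X : ι → Ω → ℝ) (τ : ℕ → ι) (Y : ℕ → Ω → ℝ) (n : ℕ) (ω : Ω) :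
    ℝ :=
  ∑ j ∈ Finset.range n, Y j ω * (X (τ (j + 1)) ω - X (τ j) ω)

theorem elementaryIntegral_succ_mul {ι : Type*} (X X' : ι → Ω → ℝ) (τ : ℕ → ι) (Y Y' : ℕ → Ω → ℝ)
    (n : ℕ) (ω : Ω) :
    elementaryIntegral X τ Y (n + 1) ω * elementaryIntegral X' τ Y' (n + 1) ω =
      elementaryIntegral X τ Y n ω * elementaryIntegral X' τ Y' n ω
        + elementaryIntegral X τ Y n ω * Y' n ω * (X' (τ (n + 1)) ω - X' (τ n) ω)
        + elementaryIntegral X' τ Y' n ω * Y n ω * (X (τ (n + 1)) ω - X (τ n) ω)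
        + Y n ω * Y' n ω *
          ((X (τ (n + 1)) ω - X (τ n) ω) * (X' (τ (n + 1)) ω - X' (τ n) ω)) := by
  simp only [elementaryIntegral, Finset.sum_range_succ]
  ring

variable [MeasurableSpace Ω] {P : Measure Ω}

/-- The random variable `f` has finite moments of all orders; such variables form an algebra, so
that the integrability of products need not be tracked. -/
def HasMoments (f : Ω → ℝ) (P : Measure Ω) : Prop := ∀ p : ℕ, MemLp f p P

namespace HasMoments

variable {f g : Ω → ℝ}

theorem integrable (hf : HasMoments f P) : Integrable f P := by
  simpa using memLp_one_iff_integrable.1 (by simpa using hf 1)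

theorem add (hf : HasMoments f P) (hg : HasMoments g P) : HasMoments (fun ω => f ω + g ω) P :=
  fun p => (hf p).add (hg p)

theorem sub (hf : HasMoments f P) (hg : HasMoments g P) : HasMoments (fun ω => f ω - g ω) P :=
  fun p => (hf p).sub (hg p)

theorem const [IsFiniteMeasure P] (c : ℝ) : HasMoments (fun _ : Ω => c) P :=
  fun _ => memLp_const c

theorem mul (hf : HasMoments f P) (hg : HasMoments g P) : HasMoments (fun ω => f ω * g ω) P := by
  intro p
  have : ENNReal.HolderTriple ((2 * p : ℕ) : ENNReal) ((2 * p : ℕ) : ENNReal) p := ⟨by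
    push_cast
    rw [ENNReal.mul_inv (by simp) (by simp), ← add_mul, ENNReal.inv_two_add_inv_two, one_mul]⟩
  exact (hg (2 * p)).mul' (hf (2 * p))

theorem sum {ι : Type*} (s : Finset ι) {f : ι → Ω → ℝ} (hf : ∀ i ∈ s, HasMoments (f i) P) :
    HasMoments (fun ω => ∑ i ∈ s, f i ω) P :=
  fun p => memLp_finsetSum s fun i hi => hf i hi p

theorem mono (hg : HasMoments g P) (hf : AEStronglyMeasurable f P) (h : ∀ᵐ ω ∂P, |f ω| ≤ g ω) :
    HasMoments f P :=
  fun p => (hg p).mono' hf h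

end HasMoments

section Integral

variable {ι : Type*} {X X' : ι → Ω → ℝ} {τ : ℕ → ι} {Y Y' : ℕ → Ω → ℝ}

theorem hasMoments_elementaryIntegral (hX : ∀ t, HasMoments (X t) P)
    (hY : ∀ j, HasMoments (Y j) P) (n : ℕ) : HasMoments (elementaryIntegral X τ Y n) P :=
  HasMoments.sum _ fun j _ => (hY j).mul ((hX _).sub (hX _))

variable [Preorder ι] {ℱ : Filtration ι ‹MeasurableSpace Ω›}

theorem aestronglyMeasurable_elementaryIntegral (hX : Martingale X ℱ P) (hτ : Monotone τ)
    (hY : ∀ j, AEStronglyMeasurable[ℱ (τ j)] (Y j) P) (n : ℕ) :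
    AEStronglyMeasurable[ℱ (τ n)] (elementaryIntegral X τ Y n) P := by
  induction n with
  | zero => exact aestronglyMeasurable_const
  | succ n ih =>
    have hle := ℱ.mono (hτ n.le_succ)
    have hsucc : elementaryIntegral X τ Y (n + 1) =
        elementaryIntegral X τ Y n + Y n * (X (τ (n + 1)) - X (τ n)) :=
      funext fun ω => Finset.sum_range_succ _ n
    rw [hsucc]
    exact (ih.mono hle).add (((hY n).mono hle).mul ((hX.stronglyMeasurable _).sub
      ((hX.stronglyMeasurable _).mono hle)).aestronglyMeasurable)

variable [IsFiniteMeasure P]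

theorem integral_mul_martingale_sub (hX : Martingale X ℱ P) {s t : ι} (hst : s ≤ t) {Z : Ω → ℝ}
    (hZ : AEStronglyMeasurable[ℱ s] Z P) (hint : Integrable (fun ω => Z ω * (X t ω - X s ω)) P) :
    ∫ ω, Z ω * (X t ω - X s ω) ∂P = 0 := by
  have hcond : P[fun ω => X t ω - X s ω | ℱ s] =ᵐ[P] 0 := by
    filter_upwards [condExp_sub (hX.integrable t) (hX.integrable s) (ℱ s), hX.condExp_ae_eq hst,
      hX.condExp_ae_eq le_rfl] with ω h1 h2 h3
    exact h1.trans (by rw [Pi.sub_apply, h2, h3, sub_self, Pi.zero_apply])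
  have hpull : P[fun ω => Z ω * (X t ω - X s ω) | ℱ s] =ᵐ[P] 0 := by
    filter_upwards [condExp_mul_of_aestronglyMeasurable_left hZ hint
      ((hX.integrable t).sub (hX.integrable s)), hcond] with ω h1 h2
    exact h1.trans (by rw [Pi.mul_apply, h2, Pi.zero_apply, mul_zero])
  rw [← integral_condExp (ℱ.le s), integral_congr_ae hpull, Pi.zero_def, integral_zero]

theorem integral_elementaryIntegral (hX : Martingale X ℱ P) (hXm : ∀ t, HasMoments (X t) P)
    (hτ : Monotone τ) (hY : ∀ j, AEStronglyMeasurable[ℱ (τ j)] (Y j) P)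
    (hYm : ∀ j, HasMoments (Y j) P) (n : ℕ) : ∫ ω, elementaryIntegral X τ Y n ω ∂P = 0 := by
  have hterm := fun j => ((hYm j).mul ((hXm (τ (j + 1))).sub (hXm (τ j)))).integrable
  simp only [elementaryIntegral]
  rw [integral_finsetSum _ fun j _ => hterm j]
  exact Finset.sum_eq_zero fun j _ =>
    integral_mul_martingale_sub hX (hτ j.le_succ) (hY j) (hterm j)

theorem integral_elementaryIntegral_mul (hX : Martingale X ℱ P) (hXm : ∀ t, HasMoments (X t) P)
    (hX' : Martingale X' ℱ P) (hXm' : ∀ t, HasMoments (X' t) P) (hτ : Monotone τ)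
    (hY : ∀ j, AEStronglyMeasurable[ℱ (τ j)] (Y j) P) (hYm : ∀ j, HasMoments (Y j) P)
    (hY' : ∀ j, AEStronglyMeasurable[ℱ (τ j)] (Y' j) P) (hYm' : ∀ j, HasMoments (Y' j) P) (n : ℕ) :
    ∫ ω, elementaryIntegral X τ Y n ω * elementaryIntegral X' τ Y' n ω ∂P =
      ∫ ω, ∑ j ∈ Finset.range n, Y j ω * Y' j ω *
        ((X (τ (j + 1)) ω - X (τ j) ω) * (X' (τ (j + 1)) ω - X' (τ j) ω)) ∂P := by
  have hI := hasMoments_elementaryIntegral (τ := τ) hXm hYm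
  have hI' := hasMoments_elementaryIntegral (τ := τ) hXm' hYm'
  have hΔ := fun j => (hXm (τ (j + 1))).sub (hXm (τ j))
  have hΔ' := fun j => (hXm' (τ (j + 1))).sub (hXm' (τ j))
  have hdiag := fun j => ((hYm j).mul (hYm' j)).mul ((hΔ j).mul (hΔ' j))
  have h1 := fun n => (hI n).mul (hI' n)
  have h2 := fun n => ((hI n).mul (hYm' n)).mul (hΔ' n)
  have h3 := fun n => ((hI' n).mul (hYm n)).mul (hΔ n)
  induction n with
  | zero => simp [elementaryIntegral]
  | succ n ih =>
    have hcross : ∫ ω, elementaryIntegral X τ Y n ω * Y' n ω *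
        (X' (τ (n + 1)) ω - X' (τ n) ω) ∂P = 0 :=
      integral_mul_martingale_sub hX' (hτ n.le_succ)
        ((aestronglyMeasurable_elementaryIntegral hX hτ hY n).mul (hY' n))
        (h2 n).integrable
    have hcross' : ∫ ω, elementaryIntegral X' τ Y' n ω * Y n ω *
        (X (τ (n + 1)) ω - X (τ n) ω) ∂P = 0 :=
      integral_mul_martingale_sub hX (hτ n.le_succ)
        ((aestronglyMeasurable_elementaryIntegral hX' hτ hY' n).mul (hY n))
        (h3 n).integrable
    simp only [elementaryIntegral_succ_mul, Finset.sum_range_succ]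
    rw [integral_add (((h1 n).add (h2 n)).add (h3 n)).integrable (hdiag n).integrable,
      integral_add ((h1 n).add (h2 n)).integrable (h3 n).integrable,
      integral_add (h1 n).integrable (h2 n).integrable, hcross, hcross', add_zero, add_zero, ih,
      integral_add (HasMoments.sum _ fun j _ => hdiag j).integrable (hdiag n).integrable]

end Integral

end Elementary

/-! ### Counting processes with constant intensity -/

section ConstantIntensity

variable {M : ℕ} {Ω : Type*}

/-- The compensated process `N_m(t) - r t`. That it is a martingale expresses that `N_m` has the
constant intensity `r`. -/
def compensated (N : Ω → Realization M) (m : Fin M) (r : ℝ) (t : ℝ≥0) (ω : Ω) : ℝ :=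
  counts N t ω m - r * t

/-- The number of events at node `m` in `(s, t]`. -/
def increment (N : Ω → Realization M) (m : Fin M) (s t : ℝ) (ω : Ω) : ℝ :=
  ((N ω).nodeMeasure m).real (Set.Ioc s t)

variable {N : Ω → Realization M} {m : Fin M} {r : ℝ}

theorem increment_eq_natCast {s t : ℝ≥0} (hst : s ≤ t) (ω : Ω) :
    increment N m s t ω = ((N ω).count m t - (N ω).count m s : ℕ) := by
  rw [increment, Realization.nodeMeasure_real_Ioc _ _ (NNReal.coe_le_coe.2 hst),
    Nat.cast_sub ((N ω).count_mono m (NNReal.coe_le_coe.2 hst))]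

theorem compensated_sub_compensated {s t : ℝ≥0} (hst : s ≤ t) (ω : Ω) :
    compensated N m r t ω - compensated N m r s ω = increment N m s t ω - r * (t - s) := by
  rw [increment, Realization.nodeMeasure_real_Ioc _ _ (NNReal.coe_le_coe.2 hst), compensated,
    compensated, counts, counts]
  ring

theorem two_rpow_le_one_add (k : ℕ) : (2 : ℝ) ^ (2 * k - k ^ 2 : ℝ) ≤ 1 + k := by
  rcases Nat.lt_or_ge k 2 with hk | hk
  · interval_cases k <;> norm_num
  · have hk : (2 : ℝ) ≤ k := mod_cast hk
    exact (Real.rpow_le_one_of_one_le_of_nonpos one_le_two (by nlinarith)).trans (by linarith)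

theorem tendsto_sum_increment_sq (N : Ω → Realization M) (m : Fin M) (T : ℝ≥0) (ω : Ω) :
    Tendsto (fun n => ∑ j ∈ Finset.range (n + 1),
        increment N m (gridPoint T n j) (gridPoint T n (j + 1)) ω ^ 2) atTop
      (𝓝 (counts N T ω m)) := by
  have h := tendsto_leftRiemannSum_mul (T := T) (ν := (N ω).nodeMeasure m)
    (ν' := (N ω).nodeMeasure m) (f := fun _ => 1) (C := 1)
    (fun _ _ => continuousWithinAt_const) fun _ _ => abs_one.le
  rw [Realization.intervalIntegral_mul_nodeMeasure_real_singleton, if_pos rfl,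
    intervalIntegral.integral_of_le T.coe_nonneg, setIntegral_const,
    Realization.nodeMeasure_real_Ioc_zero _ _ T.coe_nonneg, smul_eq_mul, mul_one] at h
  refine h.congr fun n => Finset.sum_congr rfl fun j _ => ?_
  rw [one_mul, ← sq, increment, gridCell]

theorem sum_increment (N : Ω → Realization M) (m : Fin M) (T : ℝ≥0) (n : ℕ) (ω : Ω) :
    ∑ j ∈ Finset.range (n + 1), increment N m (gridPoint T n j) (gridPoint T n (j + 1)) ω =
      counts N T ω m := by
  have h := sum_measureReal_gridCell ((N ω).nodeMeasure m) T n
  rw [Realization.nodeMeasure_real_Ioc_zero _ _ T.coe_nonneg] at h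
  exact h

/-- The sum of `2 Δ - Δ²` over the increments `Δ` of `N_m` on the first `k` cells of the grid. It is
bounded, and at `k = n + 1` it tends to `N_m(T)` since the squares of the increments sum up to the
quadratic variation `N_m(T)`. -/
def dampedCount (N : Ω → Realization M) (m : Fin M) (T : ℝ≥0) (n k : ℕ) (ω : Ω) : ℝ :=
  ∑ j ∈ Finset.range k, (2 * increment N m (gridPoint T n j) (gridPoint T n (j + 1)) ω -
    increment N m (gridPoint T n j) (gridPoint T n (j + 1)) ω ^ 2)

theorem dampedCount_le (T : ℝ≥0) (n k : ℕ) (ω : Ω) : dampedCount N m T n k ω ≤ k := by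
  refine (Finset.sum_le_card_nsmul _ _ 1 fun j _ => ?_).trans_eq (by simp)
  linarith [sq_nonneg (increment N m (gridPoint T n j) (gridPoint T n (j + 1)) ω - 1)]

theorem norm_two_rpow_dampedCount_le (T : ℝ≥0) (n k : ℕ) (ω : Ω) :
    ‖(2 : ℝ) ^ dampedCount N m T n k ω‖ ≤ (2 : ℝ) ^ (k : ℝ) := by
  rw [Real.norm_of_nonneg (by positivity)]
  exact Real.rpow_le_rpow_of_exponent_le one_le_two (dampedCount_le T n k ω)

theorem tendsto_dampedCount (N : Ω → Realization M) (m : Fin M) (T : ℝ≥0) (ω : Ω) :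
    Tendsto (fun n => dampedCount N m T n (n + 1) ω) atTop (𝓝 (counts N T ω m)) := by
  have h := (tendsto_sum_increment_sq N m T ω).const_sub (2 * counts N T ω m)
  have hlim : 2 * counts N T ω m - counts N T ω m = counts N T ω m := by ring
  rw [hlim] at h
  refine h.congr fun n => ?_
  rw [dampedCount, Finset.sum_sub_distrib, ← Finset.mul_sum, sum_increment]

variable [MeasurableSpace Ω] {P : Measure Ω}
  {ℱ : Filtration ℝ≥0 ‹MeasurableSpace Ω›} (hN : Martingale (compensated N m r) ℱ P)

include hN

theorem stronglyMeasurable_counts (t : ℝ≥0) : StronglyMeasurable[ℱ t] fun ω => counts N t ω m := by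
  have h : (fun ω => counts N t ω m) = fun ω => compensated N m r t ω + r * t :=
    funext fun ω => (sub_add_cancel _ _).symm
  rw [h]
  exact (hN.stronglyMeasurable t).add_const _

theorem stronglyMeasurable_increment {s t : ℝ≥0} (hst : s ≤ t) :
    StronglyMeasurable[ℱ t] (increment N m s t) := by
  have h : increment N m s t = fun ω => counts N t ω m - counts N s ω m :=
    funext fun ω => Realization.nodeMeasure_real_Ioc _ _ (NNReal.coe_le_coe.2 hst)
  rw [h]
  exact (stronglyMeasurable_counts hN t).sub
    ((stronglyMeasurable_counts hN s).mono (ℱ.mono hst))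

theorem stronglyMeasurable_dampedCount (T : ℝ≥0) (n k : ℕ) :
    StronglyMeasurable[ℱ (gridPoint T n k)] (dampedCount N m T n k) := by
  refine Finset.stronglyMeasurable_fun_sum _ fun j hj => ?_
  have h := (stronglyMeasurable_increment hN (gridPoint_mono T n j.le_succ)).mono
    (ℱ.mono (gridPoint_mono T n (Finset.mem_range.1 hj)))
  exact (h.const_mul 2).sub (h.pow 2)

theorem stronglyMeasurable_two_rpow_dampedCount (T : ℝ≥0) (n k : ℕ) :
    StronglyMeasurable[ℱ (gridPoint T n k)] fun ω => (2 : ℝ) ^ dampedCount N m T n k ω :=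
  (Real.continuous_const_rpow two_ne_zero).comp_stronglyMeasurable
    (stronglyMeasurable_dampedCount hN T n k)

variable [IsProbabilityMeasure P]

theorem integrable_counts (t : ℝ≥0) : Integrable (fun ω => counts N t ω m) P :=
  ((hN.integrable t).add (integrable_const (r * t))).congr
    (.of_forall fun _ => sub_add_cancel _ _)

theorem integrable_increment {s t : ℝ≥0} (hst : s ≤ t) : Integrable (increment N m s t) P :=
  ((integrable_counts hN t).sub (integrable_counts hN s)).congr (.of_forall fun _ =>
    (Realization.nodeMeasure_real_Ioc _ _ (NNReal.coe_le_coe.2 hst)).symm)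

theorem integral_mul_increment {s t : ℝ≥0} (hst : s ≤ t) {Z : Ω → ℝ}
    (hZ : AEStronglyMeasurable[ℱ s] Z P) (hint : Integrable Z P)
    (hint' : Integrable (fun ω => Z ω * increment N m s t ω) P) :
    ∫ ω, Z ω * increment N m s t ω ∂P = r * (t - s) * ∫ ω, Z ω ∂P := by
  have hsplit : ∀ ω, Z ω * (compensated N m r t ω - compensated N m r s ω) =
      Z ω * increment N m s t ω - Z ω * (r * (t - s)) := fun ω => by
    rw [compensated_sub_compensated hst, mul_sub]
  have h := integral_mul_martingale_sub hN hst hZ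
    ((hint'.sub (hint.mul_const _)).congr (.of_forall fun ω => (hsplit ω).symm))
  simp only [hsplit] at h
  rw [integral_sub hint' (hint.mul_const _), integral_mul_const] at h
  linarith

theorem integral_increment {s t : ℝ≥0} (hst : s ≤ t) :
    ∫ ω, increment N m s t ω ∂P = r * (t - s) := by
  simpa using integral_mul_increment hN hst (Z := 1) aestronglyMeasurable_const
    (integrable_const (1 : ℝ)) (by simpa using integrable_increment hN hst)

theorem integrable_two_rpow_dampedCount (T : ℝ≥0) (n k : ℕ) :
    Integrable (fun ω => (2 : ℝ) ^ dampedCount N m T n k ω) P :=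
  .of_bound ((stronglyMeasurable_two_rpow_dampedCount hN T n k).mono (ℱ.le _)).aestronglyMeasurable
    _ (.of_forall (norm_two_rpow_dampedCount_le T n k))

theorem integral_two_rpow_dampedCount_le (T : ℝ≥0) (n k : ℕ) :
    ∫ ω, (2 : ℝ) ^ dampedCount N m T n k ω ∂P ≤ Real.exp (r * gridPoint T n k) := by
  induction k with
  | zero => simp [dampedCount, gridPoint_zero]
  | succ k ih =>
    set s := gridPoint T n k
    set t := gridPoint T n (k + 1)
    have hst : s ≤ t := gridPoint_mono T n k.le_succ
    have hint := integrable_two_rpow_dampedCount hN T n k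
    have hint' : Integrable
        (fun ω => (2 : ℝ) ^ dampedCount N m T n k ω * increment N m s t ω) P :=
      (integrable_increment hN hst).bdd_mul hint.aestronglyMeasurable
        (.of_forall (norm_two_rpow_dampedCount_le T n k))
    have hstep : ∀ ω, (2 : ℝ) ^ dampedCount N m T n (k + 1) ω ≤
        (2 : ℝ) ^ dampedCount N m T n k ω
          + (2 : ℝ) ^ dampedCount N m T n k ω * increment N m s t ω := fun ω => by
      rw [dampedCount, Finset.sum_range_succ, Real.rpow_add two_pos, ← mul_one_add]
      refine mul_le_mul_of_nonneg_left ?_ (by positivity)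
      rw [increment_eq_natCast hst]
      exact two_rpow_le_one_add _
    calc ∫ ω, (2 : ℝ) ^ dampedCount N m T n (k + 1) ω ∂P
        ≤ ∫ ω, ((2 : ℝ) ^ dampedCount N m T n k ω
            + (2 : ℝ) ^ dampedCount N m T n k ω * increment N m s t ω) ∂P :=
          integral_mono (integrable_two_rpow_dampedCount hN T n _) (hint.add hint') hstep
      _ = (r * (t - s) + 1) * ∫ ω, (2 : ℝ) ^ dampedCount N m T n k ω ∂P := by
          rw [integral_add hint hint', integral_mul_increment hN hst
            (stronglyMeasurable_two_rpow_dampedCount hN T n k).aestronglyMeasurable hint hint']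
          ring
      _ ≤ Real.exp (r * (t - s)) * Real.exp (r * s) :=
          mul_le_mul (Real.add_one_le_exp _) ih (integral_nonneg fun ω => by positivity)
            (Real.exp_pos _).le
      _ = Real.exp (r * t) := by
          rw [← Real.exp_add]
          ring_nf

theorem integrable_two_rpow_counts (T : ℝ≥0) :
    Integrable (fun ω => (2 : ℝ) ^ counts N T ω m) P := by
  have hmeas := fun n => (integrable_two_rpow_dampedCount hN T n (n + 1)).aestronglyMeasurable
  have hlim := fun ω => (Real.continuous_const_rpow two_ne_zero).continuousAt.tendsto.comp
    (tendsto_dampedCount N m T ω)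
  have hbound : ∀ n, eLpNorm (fun ω => (2 : ℝ) ^ dampedCount N m T n (n + 1) ω) 1 P ≤
      ENNReal.ofReal (Real.exp (r * T)) := fun n => by
    rw [eLpNorm_one_eq_lintegral_enorm, ← ofReal_integral_norm_eq_lintegral_enorm
      (integrable_two_rpow_dampedCount hN T n _)]
    refine ENNReal.ofReal_le_ofReal ?_
    simpa only [Real.norm_of_nonneg (Real.rpow_nonneg zero_le_two _), gridPoint_last] using
      integral_two_rpow_dampedCount_le hN T n (n + 1)
  refine memLp_one_iff_integrable.1 ⟨aestronglyMeasurable_of_tendsto_ae atTop hmeas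
    (.of_forall hlim), (Lp.eLpNorm_lim_le_liminf_eLpNorm hmeas _ (.of_forall hlim)).trans_lt ?_⟩
  exact (liminf_le_of_frequently_le' (.of_forall hbound)).trans_lt ENNReal.ofReal_lt_top

theorem hasMoments_counts (T : ℝ≥0) : HasMoments (fun ω => counts N T ω m) P := by
  have hexp : ∀ ω, Real.exp (Real.log 2 * counts N T ω m) = (2 : ℝ) ^ counts N T ω m := fun ω =>
    (Real.rpow_def_of_pos two_pos _).symm
  have hpos : Integrable (fun ω => Real.exp (Real.log 2 * counts N T ω m)) P := by
    simpa only [hexp] using integrable_two_rpow_counts hN T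
  have hlog : 0 < Real.log 2 := Real.log_pos one_lt_two
  have hmeas := ((stronglyMeasurable_counts hN T).mono (ℱ.le _)).aestronglyMeasurable (μ := P)
  have hneg : Integrable (fun ω => Real.exp (-Real.log 2 * counts N T ω m)) P :=
    .of_bound (Real.continuous_exp.comp_aestronglyMeasurable (hmeas.const_mul _)) 1
      (.of_forall fun ω => by
        rw [Real.norm_of_nonneg (Real.exp_pos _).le, Real.exp_le_one_iff, neg_mul]
        exact neg_nonpos.2 (mul_nonneg hlog.le (Nat.cast_nonneg _)))
  have hmem : (0 : ℝ) ∈ interior (integrableExpSet (fun ω => counts N T ω m) P) :=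
    mem_interior.2 ⟨Set.Ioo (-Real.log 2) (Real.log 2), fun t ht =>
      integrable_exp_mul_of_le_of_le hneg hpos ht.1.le ht.2.le, isOpen_Ioo,
      neg_lt_zero.2 hlog, hlog⟩
  exact fun p => mod_cast memLp_of_mem_interior_integrableExpSet hmem p

theorem ae_notMem_nodeTimes (T : ℝ≥0) : ∀ᵐ ω ∂P, (T : ℝ) ∉ (N ω).nodeTimes m := by
  rcases T.2.eq_or_lt' with hT | hT
  · exact .of_forall fun ω h => ((N ω).time_pos _ h).ne' hT
  have hlast : ∀ n, (gridPoint T n n : ℝ) + T / (n + 1) = T := fun n => by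
    rw [← gridPoint_succ, gridPoint_last]
  have hcell : ∀ n, gridIndex T n T = n := fun n => by
    refine gridIndex_eq ⟨?_, (gridPoint_last T n).ge⟩
    linarith [hlast n, show 0 < (T : ℝ) / (n + 1) by positivity]
  have hlim : ∀ ω, Tendsto (fun n => increment N m (gridPoint T n n) (gridPoint T n (n + 1)) ω)
      atTop (𝓝 (((N ω).nodeMeasure m).real {(T : ℝ)})) := fun ω => by
    have h := tendsto_measureReal_gridCell (ν := (N ω).nodeMeasure m) (Set.right_mem_Ioc.2 hT)
    simpa only [hcell, gridCell, increment] using h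
  have hbound : ∀ n ω, ‖increment N m (gridPoint T n n) (gridPoint T n (n + 1)) ω‖ ≤
      counts N T ω m := fun n ω => by
    rw [increment, Real.norm_of_nonneg measureReal_nonneg, counts,
      ← Realization.nodeMeasure_real_Ioc_zero _ _ T.coe_nonneg]
    exact measureReal_mono (gridCell_subset n.lt_succ_self) measure_Ioc_lt_top.ne
  have hmeas := fun n =>
    (integrable_increment hN (gridPoint_mono T n n.le_succ)).aestronglyMeasurable
  have hint := tendsto_integral_of_dominated_convergence _ hmeas (integrable_counts hN T)
    (fun n => .of_forall (hbound n)) (.of_forall hlim)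
  have hzero : Tendsto (fun n => ∫ ω, increment N m (gridPoint T n n) (gridPoint T n (n + 1)) ω ∂P)
      atTop (𝓝 0) := by
    refine (mul_zero r ▸ (tendsto_gridMesh T).const_mul r).congr fun n => ?_
    rw [integral_increment hN (gridPoint_mono T n n.le_succ), gridPoint_succ, add_sub_cancel_left]
  have hlimint := (integrable_counts hN T).mono' (aestronglyMeasurable_of_tendsto_ae atTop hmeas
    (.of_forall hlim)) (.of_forall fun ω =>
      le_of_tendsto (hlim ω).norm (.of_forall fun n => hbound n ω))
  filter_upwards [(integral_eq_zero_iff_of_nonneg (fun ω => measureReal_nonneg) hlimint).1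
    (tendsto_nhds_unique hint hzero)] with ω hω hmem
  rw [Realization.nodeMeasure_real_singleton, Set.indicator_of_mem hmem] at hω
  exact one_ne_zero hω

end ConstantIntensity

/-! ### Stochastic integrals with respect to compensated counting processes -/

section Pathwise

variable {M : ℕ} {Ω : Type*} {N : Ω → Realization M} {m m' : Fin M} {r r' : ℝ} {Y : ℝ → Ω → ℝ}

/-- The stochastic integral `∫_0^T Y_s (dN_m(s) - r ds)`, defined pathwise. -/
def stochIntegral (N : Ω → Realization M) (m : Fin M) (r : ℝ) (Y : ℝ → Ω → ℝ) (T : ℝ≥0) (ω : Ω) :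
    ℝ :=
  (∫ s in (0 : ℝ)..T, Y s ω ∂(N ω).nodeMeasure m) - r * ∫ s in (0 : ℝ)..T, Y s ω

/-- The elementary stochastic integral that samples `Y` at the left endpoints of the grid. -/
def gridIntegral (N : Ω → Realization M) (m : Fin M) (r : ℝ) (Y : ℝ → Ω → ℝ) (T : ℝ≥0) (n : ℕ) :
    Ω → ℝ :=
  elementaryIntegral (compensated N m r) (gridPoint T n) (fun j => Y (gridPoint T n j)) (n + 1)

theorem compensated_gridPoint_succ_sub (T : ℝ≥0) (n j : ℕ) (ω : Ω) :
    compensated N m r (gridPoint T n (j + 1)) ω - compensated N m r (gridPoint T n j) ω =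
      ((N ω).nodeMeasure m).real (gridCell T n j) - r * volume.real (gridCell T n j) := by
  have hle : gridPoint T n j ≤ gridPoint T n (j + 1) := gridPoint_mono T n j.le_succ
  rw [compensated_sub_compensated hle, gridCell, increment,
    Real.volume_real_Ioc_of_le (NNReal.coe_le_coe.2 hle)]

theorem gridIntegral_eq (T : ℝ≥0) (n : ℕ) (ω : Ω) :
    gridIntegral N m r Y T n ω =
      ∑ j ∈ Finset.range (n + 1),
          Y (gridPoint T n j) ω * ((N ω).nodeMeasure m).real (gridCell T n j)
        - r * ∑ j ∈ Finset.range (n + 1), Y (gridPoint T n j) ω * volume.real (gridCell T n j) := by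
  rw [gridIntegral, elementaryIntegral, Finset.mul_sum, ← Finset.sum_sub_distrib]
  refine Finset.sum_congr rfl fun j _ => ?_
  rw [compensated_gridPoint_succ_sub]
  ring

theorem abs_gridIntegral_le {T : ℝ≥0} {B : ℝ} {ω : Ω}
    (hB : ∀ t ∈ Set.Icc 0 (T : ℝ), |Y t ω| ≤ B) (n : ℕ) :
    |gridIntegral N m r Y T n ω| ≤ B * (counts N T ω m + |r| * T) := by
  have h := abs_leftRiemannSum_le (ν := (N ω).nodeMeasure m) hB n
  have h' := abs_leftRiemannSum_le (ν := volume) hB n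
  rw [Realization.nodeMeasure_real_Ioc_zero _ _ T.coe_nonneg] at h
  rw [Real.volume_real_Ioc_of_le T.coe_nonneg, sub_zero] at h'
  rw [gridIntegral_eq]
  calc _ ≤ _ := abs_sub _ _
    _ ≤ B * counts N T ω m + |r| * (B * T) :=
      add_le_add h ((abs_mul _ _).trans_le (mul_le_mul_of_nonneg_left h' (abs_nonneg r)))
    _ = B * (counts N T ω m + |r| * T) := by ring

/-- The sum of the products of `Y` with the increments of two compensated counting processes. -/
def gridCovariation (N : Ω → Realization M) (m m' : Fin M) (r r' : ℝ) (Y : ℝ → Ω → ℝ) (T : ℝ≥0)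
    (n : ℕ) (ω : Ω) : ℝ :=
  ∑ j ∈ Finset.range (n + 1), Y (gridPoint T n j) ω *
    ((compensated N m r (gridPoint T n (j + 1)) ω - compensated N m r (gridPoint T n j) ω) *
      (compensated N m' r' (gridPoint T n (j + 1)) ω - compensated N m' r' (gridPoint T n j) ω))

theorem gridCovariation_eq (T : ℝ≥0) (n : ℕ) (ω : Ω) :
    gridCovariation N m m' r r' Y T n ω =
      ∑ j ∈ Finset.range (n + 1), Y (gridPoint T n j) ω *
          ((N ω).nodeMeasure m').real (gridCell T n j) * ((N ω).nodeMeasure m).real (gridCell T n j)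
        - r' * ∑ j ∈ Finset.range (n + 1), Y (gridPoint T n j) ω *
          volume.real (gridCell T n j) * ((N ω).nodeMeasure m).real (gridCell T n j)
        - r * ∑ j ∈ Finset.range (n + 1), Y (gridPoint T n j) ω *
          volume.real (gridCell T n j) * ((N ω).nodeMeasure m').real (gridCell T n j)
        + r * r' * ∑ j ∈ Finset.range (n + 1), Y (gridPoint T n j) ω *
          volume.real (gridCell T n j) * volume.real (gridCell T n j) := by
  simp only [gridCovariation, Finset.mul_sum]
  rw [← Finset.sum_sub_distrib, ← Finset.sum_sub_distrib, ← Finset.sum_add_distrib]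
  refine Finset.sum_congr rfl fun j _ => ?_
  rw [compensated_gridPoint_succ_sub, compensated_gridPoint_succ_sub]
  ring

theorem abs_gridCovariation_le {T : ℝ≥0} {B : ℝ} {ω : Ω}
    (hB : ∀ t ∈ Set.Icc 0 (T : ℝ), |Y t ω| ≤ B) (n : ℕ) :
    |gridCovariation N m m' r r' Y T n ω| ≤
      B * (counts N T ω m + |r| * T) * (counts N T ω m' + |r'| * T) := by
  have h := fun (ν ν' : Measure ℝ) [IsLocallyFiniteMeasure ν] [IsLocallyFiniteMeasure ν'] =>
    abs_leftRiemannSum_mul_le (ν := ν) (ν' := ν') hB n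
  have hvol : volume.real (Set.Ioc 0 (T : ℝ)) = T := by
    rw [Real.volume_real_Ioc_of_le T.coe_nonneg, sub_zero]
  have hN : ∀ m, ((N ω).nodeMeasure m).real (Set.Ioc 0 (T : ℝ)) = counts N T ω m := fun m =>
    Realization.nodeMeasure_real_Ioc_zero _ _ T.coe_nonneg
  have hscale : ∀ {c x b : ℝ}, |x| ≤ b → |c * x| ≤ |c| * b := fun {c x b} hx =>
    (abs_mul c x).trans_le (mul_le_mul_of_nonneg_left hx (abs_nonneg c))
  rw [gridCovariation_eq]
  refine (abs_add_le _ _).trans (add_le_add ((abs_sub _ _).trans (add_le_add ((abs_sub _ _).trans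
    (add_le_add (h _ _) (hscale (h _ _)))) (hscale (h _ _)))) (hscale (h _ _))) |>.trans_eq ?_
  rw [hvol, hN, hN, abs_mul]
  ring

end Pathwise

/-- Unlike in `aestronglyMeasurable_of_tendsto_ae`, the measure need not live on the σ-algebra
`m`. -/
theorem aestronglyMeasurable_of_ae_tendsto {Ω E : Type*} [TopologicalSpace E] [Nonempty E]
    [TopologicalSpace.IsCompletelyMetrizableSpace E] {m₀ m : MeasurableSpace Ω} {P : Measure[m₀] Ω}
    {f : ℕ → Ω → E} {g : Ω → E} (hf : ∀ n, AEStronglyMeasurable[m] (f n) P)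
    (hlim : ∀ᵐ ω ∂P, Tendsto (f · ω) atTop (𝓝 (g ω))) : AEStronglyMeasurable[m] g P := by
  refine ⟨fun ω => limUnder atTop fun n => (hf n).mk (f n) ω,
    StronglyMeasurable.limUnder fun n => (hf n).stronglyMeasurable_mk, ?_⟩
  filter_upwards [hlim, ae_all_iff.2 fun n => (hf n).ae_eq_mk] with ω hω hmk
  exact ((hω.congr hmk).limUnder_eq).symm

section StochasticIntegral

variable {M : ℕ} {Ω : Type*} [MeasurableSpace Ω] {N : Ω → Realization M} {m m' : Fin M} {r r' : ℝ}
  {P : Measure Ω} {ℱ : Filtration ℝ≥0 ‹MeasurableSpace Ω›} {Y Y' : ℝ → Ω → ℝ}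

/-- The integrands of the stochastic integral: adapted processes with left-continuous paths that are
bounded on bounded time intervals by a random variable with moments of all orders. -/
structure IsIntegrand (Y : ℝ → Ω → ℝ) (ℱ : Filtration ℝ≥0 ‹MeasurableSpace Ω›) (P : Measure Ω) :
    Prop where
  adapted : ∀ t : ℝ≥0, AEStronglyMeasurable[ℱ t] (Y t) P
  leftContinuous : ∀ ω, ∀ t > 0, ContinuousWithinAt (Y · ω) (Set.Iic t) t
  bounded : ∀ T : ℝ≥0, ∃ B, HasMoments B P ∧ ∀ ω, ∀ t ∈ Set.Icc 0 (T : ℝ), |Y t ω| ≤ B ω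

namespace IsIntegrand

theorem mul (hY : IsIntegrand Y ℱ P) (hY' : IsIntegrand Y' ℱ P) :
    IsIntegrand (fun t ω => Y t ω * Y' t ω) ℱ P where
  adapted t := (hY.adapted t).mul (hY'.adapted t)
  leftContinuous ω t ht := (hY.leftContinuous ω t ht).mul (hY'.leftContinuous ω t ht)
  bounded T := by
    obtain ⟨B, hB, hYB⟩ := hY.bounded T
    obtain ⟨B', hB', hYB'⟩ := hY'.bounded T
    refine ⟨fun ω => B ω * B' ω, hB.mul hB', fun ω t ht => ?_⟩
    rw [abs_mul]
    exact mul_le_mul (hYB ω t ht) (hYB' ω t ht) (abs_nonneg _) ((abs_nonneg _).trans (hYB ω t ht))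

variable (hY : IsIntegrand Y ℱ P)
include hY

theorem hasMoments (t : ℝ≥0) : HasMoments (Y t) P := by
  obtain ⟨B, hB, hYB⟩ := hY.bounded t
  exact hB.mono ((hY.adapted t).mono (ℱ.le t))
    (.of_forall fun ω => hYB ω t (Set.right_mem_Icc.2 t.coe_nonneg))

theorem tendsto_leftRiemannSum (ν : Measure ℝ) [IsLocallyFiniteMeasure ν] (T : ℝ≥0) (ω : Ω) :
    Tendsto (fun n => ∑ j ∈ Finset.range (n + 1),
        Y (gridPoint T n j) ω * ν.real (gridCell T n j)) atTop
      (𝓝 (∫ s in (0 : ℝ)..T, Y s ω ∂ν)) := by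
  obtain ⟨B, -, hYB⟩ := hY.bounded T
  exact Hawkes.tendsto_leftRiemannSum (fun s hs => hY.leftContinuous ω s hs.1) (hYB ω)

theorem tendsto_leftRiemannSum_mul (ν ν' : Measure ℝ) [IsLocallyFiniteMeasure ν]
    [IsLocallyFiniteMeasure ν'] (T : ℝ≥0) (ω : Ω) :
    Tendsto (fun n => ∑ j ∈ Finset.range (n + 1),
        Y (gridPoint T n j) ω * ν'.real (gridCell T n j) * ν.real (gridCell T n j)) atTop
      (𝓝 (∫ s in (0 : ℝ)..T, Y s ω * ν'.real {s} ∂ν)) := by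
  obtain ⟨B, -, hYB⟩ := hY.bounded T
  exact Hawkes.tendsto_leftRiemannSum_mul (fun s hs => hY.leftContinuous ω s hs.1) (hYB ω)

theorem continuousWithinAt_integral {t : ℝ} (ht : 0 < t) :
    ContinuousWithinAt (fun s => ∫ ω, Y s ω ∂P) (Set.Iic t) t := by
  lift t to ℝ≥0 using ht.le
  obtain ⟨B, hB, hYB⟩ := hY.bounded t
  have hIcc : ∀ᶠ s in 𝓝[≤] (t : ℝ), s ∈ Set.Icc 0 (t : ℝ) :=
    Filter.mem_of_superset (inter_mem (mem_nhdsWithin_of_mem_nhds (lt_mem_nhds ht))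
      self_mem_nhdsWithin) fun s hs => ⟨le_of_lt hs.1, hs.2⟩
  refine continuousWithinAt_of_dominated (hIcc.mono fun s hs => ?_)
    (hIcc.mono fun s hs => .of_forall fun ω => hYB ω s hs) hB.integrable
    (.of_forall fun ω => hY.leftContinuous ω t ht)
  lift s to ℝ≥0 using hs.1
  exact (hY.hasMoments s).integrable.aestronglyMeasurable

/-- Fubini's theorem, by way of Riemann sums since the joint measurability of `Y` is unknown. -/
theorem integral_intervalIntegral (T : ℝ≥0) : Integrable (fun ω => ∫ s in (0 : ℝ)..T, Y s ω) P ∧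
    ∫ ω, (∫ s in (0 : ℝ)..T, Y s ω) ∂P = ∫ s in (0 : ℝ)..T, (∫ ω, Y s ω ∂P) := by
  obtain ⟨B, hB, hYB⟩ := hY.bounded T
  have hint := fun n j => ((hY.hasMoments (gridPoint T n j)).integrable.mul_const
    (volume.real (gridCell T n j)))
  have hmeas := fun n => (integrable_finsetSum (Finset.range (n + 1))
    fun j _ => hint n j).aestronglyMeasurable
  have hbound : ∀ n ω, ‖∑ j ∈ Finset.range (n + 1),
      Y (gridPoint T n j) ω * volume.real (gridCell T n j)‖ ≤ B ω * T := fun n ω => by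
    have h := abs_leftRiemannSum_le (ν := volume) (hYB ω) n
    rwa [Real.volume_real_Ioc_of_le T.coe_nonneg, sub_zero] at h
  have hlim := hY.tendsto_leftRiemannSum volume T
  refine ⟨(hB.integrable.mul_const _).mono' (aestronglyMeasurable_of_tendsto_ae atTop hmeas
    (.of_forall hlim)) (.of_forall fun ω =>
      le_of_tendsto (hlim ω).norm (.of_forall fun n => hbound n ω)), ?_⟩
  have h := tendsto_integral_of_dominated_convergence _ hmeas (hB.integrable.mul_const _)
    (fun n => .of_forall (hbound n)) (.of_forall hlim)
  refine tendsto_nhds_unique h ((Hawkes.tendsto_leftRiemannSum (C := ∫ ω, B ω ∂P)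
    (fun s hs => hY.continuousWithinAt_integral hs.1) fun s hs => ?_).congr fun n => ?_)
  · exact norm_integral_le_of_norm_le (f := Y s) hB.integrable (.of_forall fun ω => hYB ω s hs)
  · rw [integral_finsetSum _ fun j _ => hint n j]
    simp only [integral_mul_const]

end IsIntegrand

theorem tendsto_gridIntegral (hY : IsIntegrand Y ℱ P) (T : ℝ≥0) (ω : Ω) :
    Tendsto (fun n => gridIntegral N m r Y T n ω) atTop (𝓝 (stochIntegral N m r Y T ω)) := by
  simp only [gridIntegral_eq]
  exact (hY.tendsto_leftRiemannSum _ T ω).sub ((hY.tendsto_leftRiemannSum volume T ω).const_mul r)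

theorem tendsto_gridCovariation (hY : IsIntegrand Y ℱ P) (T : ℝ≥0) (ω : Ω) :
    Tendsto (fun n => gridCovariation N m m' r r' Y T n ω) atTop
      (𝓝 (if m = m' then ∫ s in (0 : ℝ)..T, Y s ω ∂(N ω).nodeMeasure m else 0)) := by
  have hvol : ∀ s, volume.real {(s : ℝ)} = 0 := fun s => by simp [measureReal_def]
  have h := fun m => hY.tendsto_leftRiemannSum_mul ((N ω).nodeMeasure m) volume T ω
  have h' := hY.tendsto_leftRiemannSum_mul volume volume T ω
  simp only [hvol, mul_zero, intervalIntegral.integral_zero] at h h'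
  have hlim := (((hY.tendsto_leftRiemannSum_mul ((N ω).nodeMeasure m)
    ((N ω).nodeMeasure m') T ω).sub ((h m).const_mul r')).sub ((h m').const_mul r)).add
      (h'.const_mul (r * r'))
  rw [Realization.intervalIntegral_mul_nodeMeasure_real_singleton, mul_zero, mul_zero, mul_zero,
    sub_zero, sub_zero, add_zero] at hlim
  simpa only [gridCovariation_eq] using hlim

variable (hN : Martingale (compensated N m r) ℱ P)
  (hN' : Martingale (compensated N m' r') ℱ P) (hY : IsIntegrand Y ℱ P) (hY' : IsIntegrand Y' ℱ P)

include hN hY in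
theorem aestronglyMeasurable_stochIntegral (T : ℝ≥0) :
    AEStronglyMeasurable[ℱ T] (stochIntegral N m r Y T) P := by
  refine aestronglyMeasurable_of_ae_tendsto (fun n => ?_)
    (.of_forall (tendsto_gridIntegral hY T))
  have h := aestronglyMeasurable_elementaryIntegral hN (gridPoint_mono T n)
    (fun _ => hY.adapted _) (n + 1)
  rwa [gridPoint_last] at h

variable [IsProbabilityMeasure P]

include hN in
theorem hasMoments_compensated (t : ℝ≥0) : HasMoments (compensated N m r t) P :=
  (hasMoments_counts hN t).sub (.const _)

include hN hY

theorem hasMoments_gridIntegral (T : ℝ≥0) (n : ℕ) : HasMoments (gridIntegral N m r Y T n) P :=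
  hasMoments_elementaryIntegral (hasMoments_compensated hN) (fun _ => hY.hasMoments _) _

theorem exists_abs_gridIntegral_le (T : ℝ≥0) :
    ∃ B, HasMoments B P ∧ ∀ n ω, |gridIntegral N m r Y T n ω| ≤ B ω := by
  obtain ⟨B, hB, hYB⟩ := hY.bounded T
  exact ⟨_, hB.mul ((hasMoments_counts hN T).add (.const (|r| * T))),
    fun n ω => abs_gridIntegral_le (hYB ω) n⟩

theorem hasMoments_stochIntegral (T : ℝ≥0) : HasMoments (stochIntegral N m r Y T) P := by
  obtain ⟨B, hB, hbound⟩ := exists_abs_gridIntegral_le hN hY T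
  exact hB.mono ((aestronglyMeasurable_stochIntegral hN hY T).mono (ℱ.le T)) (.of_forall fun ω =>
    le_of_tendsto (tendsto_gridIntegral hY T ω).abs (.of_forall fun n => hbound n ω))

theorem integral_stochIntegral (T : ℝ≥0) : ∫ ω, stochIntegral N m r Y T ω ∂P = 0 := by
  obtain ⟨B, hB, hbound⟩ := exists_abs_gridIntegral_le hN hY T
  refine tendsto_nhds_unique (tendsto_integral_of_dominated_convergence B
    (fun n => (hasMoments_gridIntegral hN hY T n).integrable.aestronglyMeasurable) hB.integrable
    (fun n => .of_forall (hbound n)) (.of_forall fun ω => tendsto_gridIntegral hY T ω)) ?_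
  refine tendsto_const_nhds.congr fun n => (integral_elementaryIntegral hN
    (hasMoments_compensated hN) (gridPoint_mono T n) (fun _ => hY.adapted _)
    (fun _ => hY.hasMoments _) _).symm

theorem integral_intervalIntegral_nodeMeasure (T : ℝ≥0) :
    ∫ ω, (∫ s in (0 : ℝ)..T, Y s ω ∂(N ω).nodeMeasure m) ∂P =
      r * ∫ s in (0 : ℝ)..T, (∫ ω, Y s ω ∂P) := by
  obtain ⟨hint, hswap⟩ := hY.integral_intervalIntegral T
  have hsplit : ∀ ω, ∫ s in (0 : ℝ)..T, Y s ω ∂(N ω).nodeMeasure m =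
      stochIntegral N m r Y T ω + r * ∫ s in (0 : ℝ)..T, Y s ω := fun ω =>
    (sub_add_cancel _ _).symm
  simp only [hsplit]
  rw [integral_add (hasMoments_stochIntegral hN hY T).integrable (hint.const_mul r),
    integral_stochIntegral hN hY, integral_const_mul, hswap, zero_add]

include hN' hY'

theorem integral_gridIntegral_mul (T : ℝ≥0) (n : ℕ) :
    ∫ ω, gridIntegral N m r Y T n ω * gridIntegral N m' r' Y' T n ω ∂P =
      ∫ ω, gridCovariation N m m' r r' (fun t ω => Y t ω * Y' t ω) T n ω ∂P :=
  integral_elementaryIntegral_mul hN (hasMoments_compensated hN) hN' (hasMoments_compensated hN')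
    (gridPoint_mono T n) (fun _ => hY.adapted _) (fun _ => hY.hasMoments _)
    (fun _ => hY'.adapted _) (fun _ => hY'.hasMoments _) _

theorem tendsto_integral_gridIntegral_mul (T : ℝ≥0) :
    Tendsto (fun n => ∫ ω, gridIntegral N m r Y T n ω * gridIntegral N m' r' Y' T n ω ∂P) atTop
      (𝓝 (∫ ω, stochIntegral N m r Y T ω * stochIntegral N m' r' Y' T ω ∂P)) := by
  obtain ⟨B, hB, hbound⟩ := exists_abs_gridIntegral_le hN hY T
  obtain ⟨B', hB', hbound'⟩ := exists_abs_gridIntegral_le hN' hY' T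
  refine tendsto_integral_of_dominated_convergence (fun ω => B ω * B' ω)
    (fun n => ((hasMoments_gridIntegral hN hY T n).mul
      (hasMoments_gridIntegral hN' hY' T n)).integrable.aestronglyMeasurable)
    (hB.mul hB').integrable (fun n => .of_forall fun ω => ?_)
    (.of_forall fun ω => (tendsto_gridIntegral hY T ω).mul (tendsto_gridIntegral hY' T ω))
  rw [Real.norm_eq_abs, abs_mul]
  exact mul_le_mul (hbound n ω) (hbound' n ω) (abs_nonneg _) ((abs_nonneg _).trans (hbound n ω))

omit hY' in
theorem tendsto_integral_gridCovariation (T : ℝ≥0) :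
    Tendsto (fun n => ∫ ω, gridCovariation N m m' r r' Y T n ω ∂P) atTop
      (𝓝 (if m = m' then r * ∫ s in (0 : ℝ)..T, (∫ ω, Y s ω ∂P) else 0)) := by
  obtain ⟨B, hB, hYB⟩ := hY.bounded T
  have hmeas : ∀ n, HasMoments (gridCovariation N m m' r r' Y T n) P := fun n =>
    HasMoments.sum _ fun j _ => (hY.hasMoments _).mul
      (((hasMoments_compensated hN _).sub (hasMoments_compensated hN _)).mul
        ((hasMoments_compensated hN' _).sub (hasMoments_compensated hN' _)))
  have hbound := (hB.mul ((hasMoments_counts hN T).add (.const (|r| * T)))).mul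
    ((hasMoments_counts hN' T).add (.const (|r'| * T)))
  have h := tendsto_integral_of_dominated_convergence _
    (fun n => (hmeas n).integrable.aestronglyMeasurable) hbound.integrable
    (fun n => .of_forall fun ω => abs_gridCovariation_le (hYB ω) n)
    (.of_forall fun ω => tendsto_gridCovariation hY T ω)
  split_ifs at h ⊢
  · rwa [integral_intervalIntegral_nodeMeasure hN hY] at h
  · rwa [integral_zero] at h

/-- The Itô isometry; different nodes are uncorrelated since they never have simultaneous events. -/
theorem integral_stochIntegral_mul (T : ℝ≥0) :
    ∫ ω, stochIntegral N m r Y T ω * stochIntegral N m' r' Y' T ω ∂P =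
      if m = m' then r * ∫ s in (0 : ℝ)..T, (∫ ω, Y s ω * Y' s ω ∂P) else 0 :=
  tendsto_nhds_unique (tendsto_integral_gridIntegral_mul hN hN' hY hY' T)
    ((tendsto_integral_gridCovariation hN hN' (hY.mul hY') T).congr fun n =>
      (integral_gridIntegral_mul hN hN' hY hY' T n).symm)

end StochasticIntegral

/-! ### The excitation process -/

namespace Realization

variable {M : ℕ} (x : Realization M) (β : ℝ) (m : Fin M)

theorem setIntegral_Iio_eq_intervalIntegral {t : ℝ} (ht : 0 ≤ t) (htm : t ∉ x.nodeTimes m)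
    (f : ℝ → ℝ) :
    ∫ s in Set.Iio t, f s ∂x.nodeMeasure m = ∫ s in (0 : ℝ)..t, f s ∂x.nodeMeasure m := by
  rw [intervalIntegral.integral_of_le ht]
  refine setIntegral_congr_set ?_
  filter_upwards [x.ae_mem_nodeTimes m] with s hs
  have hne : s ≠ t := fun h => htm (h ▸ hs)
  exact propext ⟨fun hst => ⟨x.time_pos _ hs, le_of_lt hst⟩, fun hst => hst.2.lt_of_ne hne⟩

theorem excitation_eq_setIntegral (t : ℝ) :
    x.excitation β m t = ∫ s in Set.Iio t, Real.exp (-β * (t - s)) ∂x.nodeMeasure m :=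
  (x.setIntegral_Iio_nodeMeasure m (fun s => Real.exp (-β * (t - s))) t).symm

theorem eventually_nodeBefore_eq (t : ℝ) :
    ∀ᶠ s in 𝓝[≤] t, x.nodeBefore m s = x.nodeBefore m t := by
  have hlt : ∀ᶠ s in 𝓝 t, ∀ e ∈ x.nodeBefore m t, e.1 < s :=
    (Finset.eventually_all _).2 fun e he => lt_mem_nhds (mem_nodeBefore.1 he).1.2
  filter_upwards [mem_nhdsWithin_of_mem_nhds hlt, eventually_mem_nhdsWithin] with s hs hst
  ext e
  simp only [mem_nodeBefore] at hs ⊢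
  exact ⟨fun h => ⟨⟨h.1.1, h.1.2.trans_le hst⟩, h.2⟩, fun h => ⟨⟨h.1.1, hs e h⟩, h.2⟩⟩

theorem continuousWithinAt_excitation (t : ℝ) :
    ContinuousWithinAt (x.excitation β m) (Set.Iic t) t := by
  have hcont : Continuous fun s => ∑ e ∈ x.nodeBefore m t, Real.exp (-β * (s - e.1)) := by
    fun_prop
  exact hcont.continuousWithinAt.congr_of_eventuallyEq
    ((x.eventually_nodeBefore_eq m t).mono fun s hs => by rw [excitation, hs]) rfl

variable {β}

theorem abs_excitation_le (hβ : 0 ≤ β) {s t : ℝ} (hst : s ≤ t) :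
    |x.excitation β m s| ≤ x.count m t := by
  have hlt : x.nodeMeasure m (Set.Iic t) ≠ ⊤ := by
    rw [nodeMeasure_Iic]
    exact ENNReal.natCast_ne_top _
  have hsub : Set.Iio s ⊆ Set.Iic t := fun u hu => (le_of_lt hu).trans hst
  have hkernel : ∀ u ∈ Set.Iio s, ‖Real.exp (-β * (s - u))‖ ≤ 1 := fun u hu => by
    rw [Real.norm_of_nonneg (Real.exp_pos _).le, Real.exp_le_one_iff, neg_mul, neg_nonpos]
    exact mul_nonneg hβ (sub_nonneg.2 (le_of_lt hu))
  rw [excitation_eq_setIntegral]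
  calc |∫ u in Set.Iio s, Real.exp (-β * (s - u)) ∂x.nodeMeasure m|
      ≤ 1 * (x.nodeMeasure m).real (Set.Iio s) :=
        norm_setIntegral_le_of_norm_le_const ((measure_mono hsub).trans_lt hlt.lt_top) hkernel
    _ ≤ (x.nodeMeasure m).real (Set.Iic t) := (one_mul _).trans_le (measureReal_mono hsub hlt)
    _ = x.count m t := by rw [measureReal_def, nodeMeasure_Iic, ENNReal.toReal_natCast]

end Realization

theorem integral_exp_kernel {b : ℝ} (hb : b ≠ 0) (a t : ℝ) :
    ∫ s in a..t, Real.exp (-b * (t - s)) = (1 - Real.exp (-b * (t - a))) / b := by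
  have hderiv : ∀ s ∈ Set.uIcc a t, HasDerivAt (fun s => Real.exp (-b * (t - s)) / b)
      (Real.exp (-b * (t - s))) s := fun s _ => by
    have h := ((((hasDerivAt_id s).const_sub t).const_mul (-b)).exp.div_const b)
    rwa [mul_neg_one, neg_neg, mul_div_cancel_right₀ _ hb] at h
  rw [intervalIntegral.integral_eq_sub_of_hasDerivAt hderiv
    (Continuous.intervalIntegrable (by fun_prop) _ _)]
  simp [sub_div]

theorem integral_exp_kernel_sub {b : ℝ} (hb : b ≠ 0) (a t : ℝ) :
    ∫ s in a..t, Real.exp (-b * (s - a)) = (1 - Real.exp (-b * (t - a))) / b := by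
  have h := intervalIntegral.integral_comp_sub_left (a := a) (b := t)
    (fun s => Real.exp (-b * (s - a))) (a + t)
  rw [add_sub_cancel_right, add_sub_cancel_left] at h
  rw [← h, ← integral_exp_kernel hb]
  congr with s
  ring_nf

theorem Realization.integral_excitation {M : ℕ} (x : Realization M) {β : ℝ} (hβ : β ≠ 0)
    (m : Fin M) {T : ℝ} (hT : 0 ≤ T) :
    ∫ s in (0 : ℝ)..T, x.excitation β m s =
      ∑ e ∈ x.nodeBefore m T, (1 - Real.exp (-β * (T - e.1))) / β := by
  have hcont (e : ℝ × Fin M) : Continuous fun s => Real.exp (-β * (s - e.1)) := by fun_prop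
  have hsum : Set.EqOn (x.excitation β m) (fun s => ∑ e ∈ x.nodeBefore m T,
      (Set.Ioi e.1).indicator (fun s => Real.exp (-β * (s - e.1))) s) (Set.uIcc 0 T) := by
    intro s hs
    rw [Set.uIcc_of_le hT] at hs
    simp only [Set.indicator_apply, Set.mem_Ioi, ← Finset.sum_filter, excitation]
    congr 1
    ext e
    simp only [Finset.mem_filter, mem_nodeBefore]
    exact ⟨fun h => ⟨⟨⟨h.1.1, h.1.2.trans_le hs.2⟩, h.2⟩, h.1.2⟩, fun h => ⟨⟨h.1.1.1, h.2⟩, h.1.2⟩⟩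
  rw [intervalIntegral.integral_congr hsum, intervalIntegral.integral_finsetSum fun e _ =>
    intervalIntegrable_iff.2 (((hcont e).integrableOn_uIoc).indicator measurableSet_Ioi)]
  refine Finset.sum_congr rfl fun e he => ?_
  obtain ⟨⟨hmem, hlt⟩, -⟩ := mem_nodeBefore.1 he
  rw [← integral_exp_kernel_sub hβ, intervalIntegral.integral_of_le hT,
    intervalIntegral.integral_of_le hlt.le, setIntegral_indicator measurableSet_Ioi,
    Set.Ioc_inter_Ioi, max_eq_right (x.time_pos e hmem).le]

section Excitation

variable {M : ℕ} {Ω : Type*} [MeasurableSpace Ω] {N : Ω → Realization M} {m m' : Fin M} {r r' β : ℝ}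
  {P : Measure Ω} {ℱ : Filtration ℝ≥0 ‹MeasurableSpace Ω›}

theorem integral_add_mul_add_of_integral_eq_zero [IsProbabilityMeasure P] {f g : Ω → ℝ}
    (hf : MemLp f 2 P) (hg : MemLp g 2 P) (hf0 : ∫ ω, f ω ∂P = 0) (hg0 : ∫ ω, g ω ∂P = 0)
    (a b : ℝ) : ∫ ω, (f ω + a) * (g ω + b) ∂P = ∫ ω, f ω * g ω ∂P + a * b := by
  have hfi := hf.integrable one_le_two
  have hgi := hg.integrable one_le_two
  have hfa : MemLp (fun ω => f ω + a) 2 P := hf.add (memLp_const a)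
  have hgb : MemLp (fun ω => g ω + b) 2 P := hg.add (memLp_const b)
  have hcov : cov[fun ω => f ω + a, fun ω => g ω + b; P] = cov[f, g; P] := by
    rw [covariance_add_const_left hfi, covariance_add_const_right hgi]
  rw [covariance_eq_sub hfa hgb, covariance_eq_sub hf hg] at hcov
  simp only [Pi.mul_apply, hf0, integral_add hfi (integrable_const a),
    integral_add hgi (integrable_const b), hg0, integral_const, probReal_univ, one_smul, zero_add,
    mul_zero, sub_zero] at hcov
  linarith

theorem isIntegrand_of_continuous [IsFiniteMeasure P] {f : ℝ → ℝ} (hf : Continuous f) :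
    IsIntegrand (fun s _ => f s) ℱ P where
  adapted _ := aestronglyMeasurable_const
  leftContinuous _ _ _ := hf.continuousWithinAt
  bounded T := by
    obtain ⟨C, hC⟩ := isCompact_Icc.exists_bound_of_continuousOn (s := Set.Icc 0 (T : ℝ))
      hf.continuousOn
    exact ⟨fun _ => C, .const C, fun _ => hC⟩

variable [IsProbabilityMeasure P] (hN : Martingale (compensated N m r) ℱ P)
  (hN' : Martingale (compensated N m' r') ℱ P)

include hN

/-- Almost surely there is no event at time `t`, so it does not matter that the excitation only
takes the events before `t` into account. -/
theorem excitation_ae_eq (hβ : β ≠ 0) (t : ℝ≥0) :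
    (fun ω => (N ω).excitation β m t) =ᵐ[P] fun ω =>
      stochIntegral N m r (fun s _ => Real.exp (-β * (t - s))) t ω
        + r * ((1 - Real.exp (-β * t)) / β) := by
  have hkernel := integral_exp_kernel hβ 0 (t : ℝ)
  rw [sub_zero] at hkernel
  filter_upwards [ae_notMem_nodeTimes hN t] with ω hω
  rw [Realization.excitation_eq_setIntegral,
    Realization.setIntegral_Iio_eq_intervalIntegral _ _ t.coe_nonneg hω, stochIntegral, hkernel,
    sub_add_cancel]

theorem isIntegrand_excitation (hβ : 0 < β) :
    IsIntegrand (fun t ω => (N ω).excitation β m t) ℱ P where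
  adapted t := ((aestronglyMeasurable_stochIntegral hN (isIntegrand_of_continuous (by fun_prop))
    t).add aestronglyMeasurable_const).congr (excitation_ae_eq hN hβ.ne' t).symm
  leftContinuous ω t _ := (N ω).continuousWithinAt_excitation β m t
  bounded T := ⟨_, hasMoments_counts hN T, fun ω _ ht => (N ω).abs_excitation_le m hβ.le ht.2⟩

include hN'

theorem integral_excitation_mul (hβ : 0 < β) (t : ℝ≥0) :
    ∫ ω, (N ω).excitation β m t * (N ω).excitation β m' t ∂P =
      (if m = m' then r * ((1 - Real.exp (-(2 * β) * t)) / (2 * β)) else 0)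
        + r * r' * ((1 - Real.exp (-β * t)) / β) ^ 2 := by
  have hY : IsIntegrand (fun s (_ : Ω) => Real.exp (-β * (t - s))) ℱ P :=
    isIntegrand_of_continuous (by fun_prop)
  have hkernel_sq : ∫ s in (0 : ℝ)..t, Real.exp (-β * (t - s)) * Real.exp (-β * (t - s)) =
      (1 - Real.exp (-(2 * β) * t)) / (2 * β) := by
    have h := integral_exp_kernel (b := 2 * β) (by positivity) 0 (t : ℝ)
    rw [sub_zero] at h
    rw [← h]
    congr with s
    rw [← Real.exp_add]
    ring_nf
  rw [integral_congr_ae ((excitation_ae_eq hN hβ.ne' t).fun_mul (excitation_ae_eq hN' hβ.ne' t)),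
    integral_add_mul_add_of_integral_eq_zero
    (hasMoments_stochIntegral hN hY t 2) (hasMoments_stochIntegral hN' hY t 2)
    (integral_stochIntegral hN hY t) (integral_stochIntegral hN' hY t),
    integral_stochIntegral_mul hN hN' hY hY]
  simp only [integral_const, probReal_univ, one_smul, hkernel_sq]
  ring

end Excitation

/-! ### Covariances of the normalized scores -/

theorem tendsto_inv_mul_intervalIntegral {f : ℝ → ℝ} {l : ℝ} (hf : Continuous f)
    (hlim : Tendsto f atTop (𝓝 l)) :
    Tendsto (fun T => T⁻¹ * ∫ s in (0 : ℝ)..T, f s) atTop (𝓝 l) := by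
  obtain ⟨C, hC⟩ : ∃ C, ∀ s, 0 ≤ s → ‖f s‖ ≤ C := by
    obtain ⟨T, hT⟩ := eventually_atTop.1 (hlim.norm.eventually (gt_mem_nhds (lt_add_one ‖l‖)))
    obtain ⟨C, hC⟩ := isCompact_Icc.exists_bound_of_continuousOn (s := Set.Icc 0 T) hf.continuousOn
    refine ⟨max C (‖l‖ + 1), fun s hs => ?_⟩
    rcases le_total s T with hsT | hsT
    · exact le_max_of_le_left (hC s ⟨hs, hsT⟩)
    · exact le_max_of_le_right (hT s hsT).le
  have hscale : (fun T => ∫ u in (0 : ℝ)..1, f (T * u)) =ᶠ[atTop] fun T =>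
      T⁻¹ * ∫ s in (0 : ℝ)..T, f s := by
    filter_upwards [eventually_ne_atTop 0] with T hT
    rw [intervalIntegral.integral_comp_mul_left f hT, mul_zero, mul_one, smul_eq_mul]
  have hdom : Tendsto (fun T => ∫ u in (0 : ℝ)..1, f (T * u)) atTop
      (𝓝 (∫ _ in (0 : ℝ)..1, l)) := by
    refine intervalIntegral.tendsto_integral_filter_of_dominated_convergence (fun _ => C)
      (.of_forall fun T => Continuous.aestronglyMeasurable (by fun_prop)) ?_
      intervalIntegrable_const (.of_forall fun u hu => ?_)
    · filter_upwards [eventually_ge_atTop 0] with T hT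
      refine .of_forall fun u hu => hC _ (mul_nonneg hT ?_)
      exact (Set.uIoc_of_le (zero_le_one (α := ℝ)) ▸ hu).1.le
    · exact hlim.comp (tendsto_id.atTop_mul_const (Set.uIoc_of_le (zero_le_one (α := ℝ)) ▸ hu).1)
  rw [intervalIntegral.integral_const, sub_zero, one_smul] at hdom
  exact hdom.congr' hscale

section Score

variable {M : ℕ} {Ω : Type*} [MeasurableSpace Ω] {N : Ω → Realization M} {μ : Fin M → ℝ} {β : ℝ}
  {P : Measure Ω}

theorem IsHawkes.martingale_compensated (hN : IsHawkes P N μ β 0) (m : Fin M) :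
    Martingale (compensated N m (μ m))
      (Filtration.natural (counts N) hN.stronglyMeasurable_counts) P := by
  have h := hN.martingale m
  simp only [Realization.intensity, Matrix.zero_apply, zero_mul, Finset.sum_const_zero, add_zero,
    intervalIntegral.integral_const, sub_zero, smul_eq_mul, mul_comm _ (μ m)] at h
  exact h

variable {ℱ : Filtration ℝ≥0 ‹MeasurableSpace Ω›} [IsProbabilityMeasure P]

theorem tendsto_inv_mul_integral_excitation_mul {m m' : Fin M} {r r' : ℝ}
    (hN : Martingale (compensated N m r) ℱ P) (hN' : Martingale (compensated N m' r') ℱ P)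
    (hβ : 0 < β) :
    Tendsto (fun T => T⁻¹ * ∫ s in (0 : ℝ)..T,
      (∫ ω, (N ω).excitation β m s * (N ω).excitation β m' s ∂P)) atTop
      (𝓝 ((if m = m' then r * (1 / (2 * β)) else 0) + r * r' * (1 / β) ^ 2)) := by
  have hexp {b : ℝ} (hb : 0 < b) :
      Tendsto (fun t => (1 - Real.exp (-b * t)) / b) atTop (𝓝 (1 / b)) := by
    have h := Real.tendsto_exp_atBot.comp (tendsto_id.const_mul_atTop_of_neg (neg_lt_zero.2 hb))
    simpa using (h.const_sub 1).div_const b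
  have hmoment : Tendsto (fun t => (if m = m' then r * ((1 - Real.exp (-(2 * β) * t)) / (2 * β))
      else 0) + r * r' * ((1 - Real.exp (-β * t)) / β) ^ 2) atTop
      (𝓝 ((if m = m' then r * (1 / (2 * β)) else 0) + r * r' * (1 / β) ^ 2)) := by
    refine .add ?_ (((hexp hβ).pow 2).const_mul _)
    split_ifs
    · exact (hexp (by positivity)).const_mul r
    · exact tendsto_const_nhds
  refine (tendsto_inv_mul_intervalIntegral (by split_ifs <;> fun_prop) hmoment).congr' ?_
  filter_upwards [eventually_ge_atTop 0] with T hT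
  congr 1
  refine intervalIntegral.integral_congr fun s hs => ?_
  lift s to ℝ≥0 using (Set.uIcc_of_le hT ▸ hs).1
  exact (integral_excitation_mul hN hN' hβ s).symm

variable (hμ : ∀ m, 0 < μ m) (hβ : 0 < β) (hN : ∀ m, Martingale (compensated N m (μ m)) ℱ P)

include hμ hβ hN

theorem score_ae_eq (p q : Fin M) (T : ℝ≥0) :
    (fun ω => (N ω).score μ β T p q 0) =ᵐ[P] fun ω =>
      (μ q)⁻¹ * stochIntegral N q (μ q) (fun t ω => (N ω).excitation β p t) T ω := by
  filter_upwards [ae_notMem_nodeTimes (hN q) T] with ω hω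
  rw [Realization.score_zero _ hμ, ← Realization.setIntegral_Iio_nodeMeasure,
    Realization.setIntegral_Iio_eq_intervalIntegral _ _ T.coe_nonneg hω, stochIntegral,
    Realization.integral_excitation _ hβ.ne' _ T.coe_nonneg, mul_sub,
    inv_mul_cancel_left₀ (hμ q).ne', div_eq_inv_mul]

theorem normalizedScore_ae_eq (p q : Fin M) (T : ℝ≥0) :
    normalizedScore N μ β T p q 0 =ᵐ[P] fun ω =>
      (T : ℝ) ^ (-(1 / 2) : ℝ) * ((μ q)⁻¹ *
        stochIntegral N q (μ q) (fun t ω => (N ω).excitation β p t) T ω) :=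
  (score_ae_eq hμ hβ hN p q T).fun_const_smul ((T : ℝ) ^ (-(1 / 2) : ℝ))

theorem memLp_normalizedScore (p q : Fin M) {T : ℝ} (hT : 0 ≤ T) :
    MemLp (normalizedScore N μ β T p q 0) 2 P := by
  lift T to ℝ≥0 using hT
  exact (((hasMoments_stochIntegral (hN q) (isIntegrand_excitation (hN p) hβ) T 2).const_mul
    _).const_mul _).ae_eq (normalizedScore_ae_eq hμ hβ hN p q T).symm

theorem covariance_normalizedScore (p q p' q' : Fin M) {T : ℝ} (hT : 0 < T) :
    cov[normalizedScore N μ β T p q 0, normalizedScore N μ β T p' q' 0; P] =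
      if q = q' then (μ q)⁻¹ * (T⁻¹ * ∫ s in (0 : ℝ)..T,
        (∫ ω, (N ω).excitation β p s * (N ω).excitation β p' s ∂P)) else 0 := by
  lift T to ℝ≥0 using hT.le
  have hR := isIntegrand_excitation (hN p) hβ
  have hR' := isIntegrand_excitation (hN p') hβ
  have hsq : (T : ℝ) ^ (-(1 / 2) : ℝ) * (T : ℝ) ^ (-(1 / 2) : ℝ) = (T : ℝ)⁻¹ := by
    rw [← Real.rpow_add hT, ← Real.rpow_neg_one]
    norm_num
  have hscore := normalizedScore_ae_eq hμ hβ hN p q T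
  have hscore' := normalizedScore_ae_eq hμ hβ hN p' q' T
  have hmean : ∫ ω, normalizedScore N μ β T p q 0 ω ∂P = 0 := by
    rw [integral_congr_ae hscore, integral_const_mul, integral_const_mul,
      integral_stochIntegral (hN q) hR, mul_zero, mul_zero]
  rw [covariance_eq_sub (memLp_normalizedScore hμ hβ hN p q hT.le)
    (memLp_normalizedScore hμ hβ hN p' q' hT.le), hmean, zero_mul, sub_zero,
    integral_congr_ae (hscore.mul hscore')]
  simp only [Pi.mul_apply, mul_mul_mul_comm _ _ (_ ^ _), hsq, mul_mul_mul_comm (μ q)⁻¹]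
  rw [integral_const_mul, integral_const_mul,
    integral_stochIntegral_mul (hN q) (hN q') hR hR']
  split_ifs with h
  · subst h
    have := (hμ q).ne'
    field_simp
  · simp only [mul_zero]

theorem tendsto_covariance_normalizedScore (p q p' q' : Fin M) :
    Tendsto (fun T : ℝ => cov[normalizedScore N μ β T p q 0, normalizedScore N μ β T p' q' 0; P])
      atTop (𝓝 (if q = q' then (μ q)⁻¹ * ((if p = p' then μ p * (1 / (2 * β)) else 0) +
        μ p * μ p' * (1 / β) ^ 2) else 0)) := by
  have hlim : Tendsto (fun T => if q = q' then (μ q)⁻¹ * (T⁻¹ * ∫ s in (0 : ℝ)..T,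
      (∫ ω, (N ω).excitation β p s * (N ω).excitation β p' s ∂P)) else 0) atTop
      (𝓝 (if q = q' then (μ q)⁻¹ * ((if p = p' then μ p * (1 / (2 * β)) else 0) +
        μ p * μ p' * (1 / β) ^ 2) else 0)) := by
    by_cases hq : q = q'
    · simp only [if_pos hq]
      exact (tendsto_inv_mul_integral_excitation_mul (hN p) (hN p') hβ).const_mul _
    · simp only [if_neg hq]
      exact tendsto_const_nhds
  refine hlim.congr' ?_
  filter_upwards [eventually_gt_atTop 0] with T hT
  exact (covariance_normalizedScore hμ hβ hN p q p' q' hT).symm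

theorem tendsto_variance_normalizedScore (p q : Fin M) :
    Tendsto (fun T : ℝ => Var[normalizedScore N μ β T p q 0; P]) atTop
      (𝓝 (μ p / μ q * (1 / (2 * β) + μ p / β ^ 2))) := by
  have hlim := tendsto_covariance_normalizedScore hμ hβ hN p q p q
  have hval : (μ q)⁻¹ * (μ p * (1 / (2 * β)) + μ p * μ p * (1 / β) ^ 2) =
      μ p / μ q * (1 / (2 * β) + μ p / β ^ 2) := by ring
  rw [if_pos rfl, if_pos rfl, hval] at hlim
  refine hlim.congr' ?_
  filter_upwards [eventually_ge_atTop 0] with T hT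
  exact covariance_self (memLp_normalizedScore hμ hβ hN p q hT).aestronglyMeasurable.aemeasurable

end Score

end Hawkes

end

theorem theorem1 {M : ℕ} (μ : Fin M → ℝ) (hμ : ∀ m, 0 < μ m) (β : ℝ) (hβ : 0 < β) :
    -- the closed form of the score, for every realization of the process
    (∀ A : Matrix (Fin M) (Fin M) ℝ, (∀ i j, 0 ≤ A i j) →
      ∀ (x : Hawkes.Realization M) (T : ℝ) (p q : Fin M),
        LineDifferentiableAt ℝ (x.logLikelihood μ β T) A (Matrix.single p q 1) ∧
        x.score μ β T p q A =
          (∑ k ∈ x.nodeBefore q T,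
            (∑ i ∈ x.nodeBefore p k.1, Real.exp (-β * (k.1 - i.1))) /
              (μ q + ∑ i ∈ x.before k.1, A i.2 q * Real.exp (-β * (k.1 - i.1))))
          + (1 / β) * ∑ k ∈ x.nodeBefore p T, (Real.exp (-β * (T - k.1)) - 1)) ∧
    -- the limits of the variances and covariances of the normalized scores when `A = 0`
    (∀ {Ω : Type*} [MeasurableSpace Ω] (P : Measure Ω) [IsProbabilityMeasure P]
      (N : Ω → Hawkes.Realization M), Hawkes.IsHawkes P N μ β 0 →
        (∀ T : ℝ, 0 < T → ∀ p q, MemLp (Hawkes.normalizedScore N μ β T p q 0) 2 P) ∧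
        (∀ q, Tendsto (fun T : ℝ => variance (Hawkes.normalizedScore N μ β T q q 0) P) atTop
          (𝓝 (1 / (2 * β) + μ q / β ^ 2))) ∧
        (∀ p q, p ≠ q →
          Tendsto (fun T : ℝ => variance (Hawkes.normalizedScore N μ β T p q 0) P) atTop
            (𝓝 (μ p / μ q * (1 / (2 * β) + μ p / β ^ 2)))) ∧
        (∀ p p' q, p ≠ p' →
          Tendsto (fun T : ℝ => covariance (Hawkes.normalizedScore N μ β T p q 0)
            (Hawkes.normalizedScore N μ β T p' q 0) P) atTop
            (𝓝 (μ p * μ p' / (μ q * β ^ 2)))) ∧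
        (∀ p q p' q', q ≠ q' →
          Tendsto (fun T : ℝ => covariance (Hawkes.normalizedScore N μ β T p q 0)
            (Hawkes.normalizedScore N μ β T p' q' 0) P) atTop (𝓝 0))) := by
  refine ⟨fun A hA x T p q => ?_, fun P _ N hawkes => ?_⟩
  · have hderiv := x.hasLineDerivAt_logLikelihood hμ β T hA p q
    exact ⟨hderiv.lineDifferentiableAt, hderiv.lineDeriv⟩
  have hN := hawkes.martingale_compensated
  have hcov := Hawkes.tendsto_covariance_normalizedScore hμ hβ hN
  have hvar := Hawkes.tendsto_variance_normalizedScore hμ hβ hN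
  refine ⟨fun T hT p q => Hawkes.memLp_normalizedScore hμ hβ hN p q hT.le, fun q => ?_,
    fun p q _ => hvar p q, fun p p' q hp => ?_, fun p q p' q' hq => ?_⟩
  · simpa only [div_self (hμ q).ne', one_mul] using hvar q q
  · have hlim := hcov p q p' q
    rw [if_pos rfl, if_neg hp, zero_add] at hlim
    convert hlim using 2
    ring
  · simpa only [if_neg hq] using hcov p q p' q'
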